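/- Let $\Delta\subset\mathbb{R}^2$ be the closed equilateral triangle with vertices $(1,0)$, $(-\tfrac12,\tfrac{\sqrt3}{2})$, $(-\tfrac12,-\tfrac{\sqrt3}{2})$. Let $\sigma$ be the counter-clockwise rotation by $120^\circ$ about the origin and $\mu(x,y)=(x,-y)$, acting on functions by $(\alpha f)(p)=f(\alpha^{-1}p)$. A *Dirichlet solution with scalar $c\in\mathbb{R}$* is a function $f:\Delta\to\mathbb{R}$, not identically zero, continuous on $\Delta$ and twice continuously differentiable in its interior, with $\nabla^2 f+cf=0$ in the interior and $f=0$ on $\partial\Delta$. Such an $f$ belongs to class A2 if $\sigma f=f$ and $\mu f=-f$ on $\Delta$, and to class E2 if $\sigma f\neq f$, $\sigma f\ne -f$ and $\mu f=-f$ on $\Delta$ (here $\sigma f \neq \pm f$ means inequality as functions on $\Delta$). Let $T$ be the affine bijection of the plane $$T(x,y)=\tfrac16\bigl(3x+\sqrt3\,y+3,\;-\sqrt3\,x+3y+\sqrt3\bigr).$$ It maps the closed lower half $H$ of $\Delta$, i.e. the triangle with vertices $(1,0)$, $(-\tfrac12,0)$, $(-\tfrac12,-\tfrac{\sqrt3}{2})$,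 onto the triangle $D\subset\Delta$ with vertices $(1,0)$, $(\tfrac14,\tfrac{\sqrt3}{4})$, $(0,0)$. For a closed triangle $K$ and a function $h$ on $K$, a *reflection tessellation* of $h$ is a function on the plane that agrees with $h$ on $K$ and changes sign under the reflection in each of the three lines containing the sides of $K$. Let $k\in\mathbb{R}$. 1. Let $f$ be a solution in class E2 or A2 with scalar $k^2$. Then the function $f\circ T^{-1}$ on $D$ has a reflection tessellation, and every reflection tessellation $G$ of it (restricted to $\Delta$) is a solution in class A2 with scalar $3k^2$. 2. Let $g$ be a solution in class A2 with scalar $k^2$. Then the function $g\circ T$ on $H$ has a reflection tessellation, and every reflection tessellation $F$ of it (restricted to $\Delta$) is a solution in class A2 or E2 with scalar $k^2/3$. 3. The two constructions are inverse to each other: applying construction 2 to any function $G$ produced from $f$ in 1 gives back $f$ on $\Delta$, and applying construction 1 to any function $F$ produced from $g$ in 2 gives back $g$ on $\Delta$. -/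

import Mathlib

open scoped Laplacian

noncomputable section

/-- The Euclidean plane. -/
abbrev Plane : Type := EuclideanSpace ℝ (Fin 2)

namespace EquilateralHelmholtz

/-- The closed equilateral triangle centred at the origin, with vertices at distance one from it
and symmetric about the `x`-axis. -/
def triangle : Set Plane :=
  convexHull ℝ {!₂[(1 : ℝ), 0], !₂[-1 / 2, √3 / 2], !₂[-1 / 2, -√3 / 2]}

/-- The matrix of the counter-clockwise rotation by 120 degrees. -/
def rotationMatrix : Matrix (Fin 2) (Fin 2) ℝ :=
  !![-1 / 2, -√3 / 2; √3 / 2, -1 / 2]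

/-- The matrix of the reflection in the `x`-axis. -/
def reflectionMatrix : Matrix (Fin 2) (Fin 2) ℝ :=
  !![1, 0; 0, -1]

/-- The action of a matrix on functions, `(A • f) (p) = f (A⁻¹ p)`. -/
def act (A : Matrix (Fin 2) (Fin 2) ℝ) (f : Plane → ℝ) : Plane → ℝ :=
  fun p => f (WithLp.toLp 2 (A⁻¹.mulVec p.ofLp))

/-- `f` is a nontrivial classical solution of the Dirichlet problem for the Helmholtz equation
`∇² f + c f = 0` in the triangle: it is continuous on the closed triangle, twice continuously
differentiable in its interior, and it vanishes on the boundary. Only the values of `f` on the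
closed triangle matter. -/
structure IsDirichletSolution (c : ℝ) (f : Plane → ℝ) : Prop where
  continuousOn : ContinuousOn f triangle
  contDiffOn : ContDiffOn ℝ 2 f (interior triangle)
  helmholtz : ∀ p ∈ interior triangle, Laplacian.laplacian f p + c * f p = 0
  boundary : ∀ p ∈ frontier triangle, f p = 0
  nontrivial : ∃ p ∈ triangle, f p ≠ 0

/-- Solutions that are symmetric under the rotation and antisymmetric under the reflection. -/
def classA2 (c : ℝ) : Set (Plane → ℝ) :=
  {f | IsDirichletSolution c f ∧
    Set.EqOn (act rotationMatrix f) f triangle ∧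
    Set.EqOn (act reflectionMatrix f) (-f) triangle}

/-- Solutions that are asymmetric under the rotation (neither symmetric nor antisymmetric) and
antisymmetric under the reflection. -/
def classE2 (c : ℝ) : Set (Plane → ℝ) :=
  {f | IsDirichletSolution c f ∧
    ¬ Set.EqOn (act rotationMatrix f) f triangle ∧
    ¬ Set.EqOn (act rotationMatrix f) (-f) triangle ∧
    Set.EqOn (act reflectionMatrix f) (-f) triangle}

/-- The affine map `T` of the plane, together with its inverse. -/
def trans : Plane ≃ Plane where
  toFun p := !₂[(3 * p 0 + √3 * p 1 + 3) / 6, (-√3 * p 0 + 3 * p 1 + √3) / 6]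
  invFun q := !₂[(3 * q 0 - √3 * q 1 - 1) / 2, (√3 * q 0 + 3 * q 1 - √3) / 2]
  left_inv p := by
    have h : √3 * √3 = 3 := Real.mul_self_sqrt (by norm_num)
    ext i
    fin_cases i
    · simp; linear_combination (p 0 / 12 - 1 / 12) * h
    · simp; linear_combination (p 1 / 12) * h
  right_inv q := by
    have h : √3 * √3 = 3 := Real.mul_self_sqrt (by norm_num)
    ext i
    fin_cases i
    · simp; linear_combination (q 0 / 12 - 1 / 12) * h
    · simp; linear_combination (q 1 / 12) * h

/-- `G` is obtained from the values of `h` on the closed triangle with vertices `a`, `b`, `c` by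
tessellating the plane: `G` agrees with `h` on that triangle and changes sign under the
reflection in each of the three lines that contain its sides. -/
structure IsTessellation (a b c : Plane) (h G : Plane → ℝ) : Prop where
  eqOn : Set.EqOn G h (convexHull ℝ {a, b, c})
  odd₁ : ∀ p, G (EuclideanGeometry.reflection (affineSpan ℝ {a, b}) p) = -G p
  odd₂ : ∀ p, G (EuclideanGeometry.reflection (affineSpan ℝ {b, c}) p) = -G p
  odd₃ : ∀ p, G (EuclideanGeometry.reflection (affineSpan ℝ {a, c}) p) = -G p

/-- `G` is the function produced from `f`: compose the restriction of `f` to the lower half of the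
triangle, which has vertices `(1, 0)`, `(-1/2, 0)`, `(-1/2, -√3/2)`, with `T⁻¹`, and tessellate. The
points below are the images of these vertices under `T`. -/
def IsForwardImage (f G : Plane → ℝ) : Prop :=
  IsTessellation !₂[(1 : ℝ), 0] !₂[1 / 4, √3 / 4] !₂[0, 0] (f ∘ trans.symm) G

/-- `F` is the function produced from `g` by the reverse construction: compose `g` with `T`
on the lower half of the triangle, and tessellate. -/
def IsBackwardImage (g F : Plane → ℝ) : Prop :=
  IsTessellation !₂[(1 : ℝ), 0] !₂[-1 / 2, 0] !₂[-1 / 2, -√3 / 2] (g ∘ trans) F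

theorem trans_vertices :
    trans !₂[(1 : ℝ), 0] = !₂[(1 : ℝ), 0] ∧
    trans !₂[(-1 / 2 : ℝ), 0] = !₂[1 / 4, √3 / 4] ∧
    trans !₂[(-1 / 2 : ℝ), -√3 / 2] = !₂[(0 : ℝ), 0] := by
  have h : √3 * √3 = 3 := Real.mul_self_sqrt (by norm_num)
  refine ⟨?_, ?_, ?_⟩ <;> ext i <;> fin_cases i <;> simp [trans] <;> ring_nf <;>
    (try rw [Real.sq_sqrt (by norm_num)]) <;> norm_num

end EquilateralHelmholtz

end

/-!
The two constructions are inverse to each other on the level of values: a tessellation is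
determined on the triangle by its values on the tile, because the triangle consists of two mirror
images of its lower half and of six mirror images of `sixth`. What needs an argument is that
tessellations exist and that they are classical solutions across the mirrors.

*Existence.* In the barycentric coordinates `(a, b)` of the second and third vertex, a function
that lives in the open triangle and is odd under the swap of `a` and `b` is summed over the six
rotations about the first vertex, which gives a function on a hexagon, and then over the
translations of a lattice whose cell is this hexagon (`latticeSum`). The sum is locally finite,
hence continuous; since the translates of the open hexagon are disjoint it is bounded and extends
the given function. The reflections in the sides are products of the swap, rotations and
translations, so the sum is odd under them. Extension by zero, followed by antisymmetrisation,
turns a function on the tile with zero boundary values into such a function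
(`exists_tessellation`).

*Smoothness across the mirrors.* Let `G` be the tessellation of a solution with scalar `c`, and let
`W t` be the heat flow started from `G`, a convolution with a Gaussian. On the tile both `W t` and
`exp (-c t) G` solve the heat equation with the same initial values, and both vanish on the
boundary of the tile: each boundary point is fixed by a reflection under which `G`, hence `W t`, is
odd. By the parabolic maximum principle they agree on the tile (`heatFlow_eq_of_odd`), and by
oddness also on all mirror images of the tile. So there `G = exp c · W 1`, up to the total mass of
the Gaussian, is smooth, and differentiating `W t = exp (-c t) G` in time gives `ΔG = -cG`
(`exists_contDiff_of_heatFlow_eq`). No regularity of the solution at the boundary of the tile is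
used, and the vertices need no separate treatment.

The similarity `T` scales lengths by `1/√3`, so composition with it divides the Laplacian by three.
Since the rotation by 120 degrees is a product of two of the mirror symmetries, a forward image is
invariant under it; a backward image lies in A2 or E2 because the rotation has order three, so that
it cannot act by the sign `-1`.
-/

namespace EquilateralHelmholtz

noncomputable section

open MeasureTheory Filter Topology

-- needed to find the norm on continuous bilinear maps
set_option maxSynthPendingDepth 3

/-! ### Convolution with decaying kernels -/

section Convolution

variable {F : Type*} [NormedAddCommGroup F] [NormedSpace ℝ F]

/-- A kernel that is continuous and decays like `‖x‖ ^ (-3)`, which in the plane is enough for its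
convolution with a bounded function to converge absolutely. -/
structure IsDecaying {V : Type*} [NormedAddCommGroup V] (K : V → F) : Prop where
  continuous : Continuous K
  bound : ∃ C, 0 ≤ C ∧ ∀ x, ‖K x‖ ≤ C * (1 + ‖x‖) ^ (-3 : ℝ)

theorem integrable_decay : Integrable (fun x : Plane => (1 + ‖x‖) ^ (-3 : ℝ)) :=
  integrable_one_add_norm (by simp; norm_num)

theorem IsDecaying.integrable_smul {K : Plane → F} (hK : IsDecaying K) {G : Plane → ℝ}
    (hG : Continuous G) {M : ℝ} (hM : ∀ p, |G p| ≤ M) (p : Plane) :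
    Integrable (fun q => G q • K (p - q)) := by
  obtain ⟨C, hC, hb⟩ := hK.bound
  have hKc := hK.continuous
  refine ((integrable_decay.comp_sub_left p).const_mul (M * C)).mono'
    (by fun_prop) (ae_of_all _ fun q => ?_)
  rw [norm_smul, Real.norm_eq_abs, mul_assoc]
  exact mul_le_mul (hM q) (hb _) (norm_nonneg _) ((abs_nonneg _).trans (hM q))

theorem IsDecaying.continuous_convolution {K : Plane → F} (hK : IsDecaying K) {G : Plane → ℝ}
    (hG : Continuous G) {M : ℝ} (hM : ∀ p, |G p| ≤ M) :
    Continuous (fun p => ∫ q, G q • K (p - q)) := by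
  obtain ⟨C, hC, hb⟩ := hK.bound
  have hKc := hK.continuous
  have h : (fun p => ∫ q, G q • K (p - q)) = fun p => ∫ x, G (p - x) • K x := by
    ext p
    rw [← integral_sub_left_eq_self _ volume p]
    simp
  rw [h]
  refine continuous_of_dominated (bound := fun x => M * C * (1 + ‖x‖) ^ (-3 : ℝ))
    (fun p => by fun_prop) (fun p => ae_of_all _ fun x => ?_) (integrable_decay.const_mul _)
    (ae_of_all _ fun x => by fun_prop)
  rw [norm_smul, Real.norm_eq_abs, mul_assoc]
  exact mul_le_mul (hM _) (hb _) (norm_nonneg _) ((abs_nonneg _).trans (hM p))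

theorem IsDecaying.hasFDerivAt_convolution {K : Plane → F} {K' : Plane → Plane →L[ℝ] F}
    (hK : IsDecaying K) (hK' : IsDecaying K') (hd : ∀ x, HasFDerivAt K (K' x) x)
    {G : Plane → ℝ} (hG : Continuous G) {M : ℝ} (hM : ∀ p, |G p| ≤ M) (p : Plane) :
    HasFDerivAt (fun p => ∫ q, G q • K (p - q)) (∫ q, G q • K' (p - q)) p := by
  obtain ⟨C, hC, hb⟩ := hK'.bound
  have hKc := hK.continuous
  have hKc' := hK'.continuous
  refine hasFDerivAt_integral_of_dominated_of_fderiv_le (𝕜 := ℝ) (Metric.ball_mem_nhds p one_pos)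
    (F := fun p q => G q • K (p - q)) (F' := fun p q => G q • K' (p - q))
    (bound := fun q => M * C * 2 ^ (3 : ℝ) * (1 + ‖p - q‖) ^ (-3 : ℝ))
    (Eventually.of_forall fun x => by fun_prop) (hK.integrable_smul hG hM p) (by fun_prop)
    (ae_of_all _ fun q x hx => ?_) ((integrable_decay.comp_sub_left p).const_mul _)
    (ae_of_all _ fun q x hx => ?_)
  · have h1 : 1 + ‖p - q‖ ≤ 2 * (1 + ‖x - q‖) := by
      have := norm_add_le (p - x) (x - q)
      rw [sub_add_sub_cancel] at this
      have h2 : ‖p - x‖ < 1 := by rwa [← dist_eq_norm, dist_comm]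
      linarith [norm_nonneg (x - q)]
    have h2 : (1 + ‖x - q‖) ^ (-3 : ℝ) ≤ 2 ^ (3 : ℝ) * (1 + ‖p - q‖) ^ (-3 : ℝ) := by
      have h3 : (2 * (1 + ‖x - q‖)) ^ (-3 : ℝ) ≤ (1 + ‖p - q‖) ^ (-3 : ℝ) :=
        Real.rpow_le_rpow_of_nonpos (by positivity) h1 (by norm_num)
      rw [Real.mul_rpow (by norm_num) (by positivity), Real.rpow_neg (by norm_num)] at h3
      calc (1 + ‖x - q‖) ^ (-3 : ℝ)
          = 2 ^ (3 : ℝ) * ((2 ^ (3 : ℝ))⁻¹ * (1 + ‖x - q‖) ^ (-3 : ℝ)) := by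
            rw [mul_inv_cancel_left₀ (by positivity)]
        _ ≤ _ := by gcongr
    rw [norm_smul, Real.norm_eq_abs]
    have hM0 : 0 ≤ M := (abs_nonneg _).trans (hM q)
    calc |G q| * ‖K' (x - q)‖ ≤ M * (C * (1 + ‖x - q‖) ^ (-3 : ℝ)) :=
          mul_le_mul (hM q) (hb _) (norm_nonneg _) hM0
      _ ≤ M * (C * (2 ^ (3 : ℝ) * (1 + ‖p - q‖) ^ (-3 : ℝ))) := by gcongr
      _ = _ := by ring
  · have := (hd (x - q)).comp x ((hasFDerivAt_id x).sub_const q)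
    simp only [ContinuousLinearMap.comp_id] at this
    exact this.const_smul (G q)

end Convolution

/-! ### The Gaussian and its derivatives -/

section Gaussian

variable {V : Type*} [NormedAddCommGroup V]

/-- The unnormalised Gaussian `exp (-s‖x‖²)`. -/
def gauss (s : ℝ) (x : V) : ℝ := Real.exp (-s * ‖x‖ ^ 2)

theorem continuous_gauss (s : ℝ) : Continuous (gauss s : V → ℝ) := by
  unfold gauss; fun_prop

theorem gauss_nonneg (s : ℝ) (x : V) : 0 ≤ gauss s x := (Real.exp_pos _).le

/-- The exponential beats every polynomial; the power five leaves room for a factor of degree two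
and the decay of order three. -/
theorem exists_gauss_le {s : ℝ} (hs : 0 < s) :
    ∃ C, 0 ≤ C ∧ ∀ x : V, (1 + ‖x‖) ^ 2 * gauss s x ≤ C * (1 + ‖x‖) ^ (-3 : ℝ) := by
  refine ⟨64 * (1 + 6 / s ^ 3), by positivity, fun x => ?_⟩
  set r := ‖x‖ with hr
  have hr0 : 0 ≤ r := norm_nonneg x
  have h1 : 1 + (s * r ^ 2) ^ 3 / 6 ≤ 2 * Real.exp (s * r ^ 2) := by
    have := Real.pow_div_factorial_le_exp (x := s * r ^ 2) (by positivity) 3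
    have h2 := Real.one_le_exp (x := s * r ^ 2) (by positivity)
    norm_num [Nat.factorial] at this
    linarith
  have h2 : (1 + r) ^ 5 ≤ 32 * (1 + r ^ 6) := by
    rcases le_total r 1 with h | h
    · have : (1 + r) ^ 5 ≤ 2 ^ 5 := by gcongr; linarith
      linarith [pow_nonneg hr0 6]
    · have : (1 + r) ^ 5 ≤ (2 * r) ^ 5 := by gcongr; linarith
      have h6 : r ^ 5 ≤ r ^ 6 := pow_le_pow_right₀ h (by norm_num)
      rw [mul_pow] at this
      linarith
  have h3 : (1 + r) ^ 5 ≤ 64 * (1 + 6 / s ^ 3) * Real.exp (s * r ^ 2) := by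
    have h4 : 1 + r ^ 6 ≤ (1 + 6 / s ^ 3) * (1 + (s * r ^ 2) ^ 3 / 6) := by
      have : (1 + 6 / s ^ 3) * (1 + (s * r ^ 2) ^ 3 / 6)
          = 1 + r ^ 6 + 6 / s ^ 3 + (s * r ^ 2) ^ 3 / 6 := by field_simp; ring
      rw [this]
      have : 0 ≤ 6 / s ^ 3 + (s * r ^ 2) ^ 3 / 6 := by positivity
      linarith
    have h5 : (1 + 6 / s ^ 3) * (1 + (s * r ^ 2) ^ 3 / 6)
        ≤ (1 + 6 / s ^ 3) * (2 * Real.exp (s * r ^ 2)) := by gcongr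
    linarith
  have h6 : (1 + r) ^ (-3 : ℝ) = ((1 + r) ^ 3)⁻¹ := by
    rw [Real.rpow_neg (by positivity)]; norm_cast
  rw [h6, ← div_eq_mul_inv, le_div_iff₀ (by positivity), gauss, neg_mul, Real.exp_neg, ← hr,
    mul_right_comm, ← pow_add, ← div_eq_mul_inv, div_le_iff₀ (Real.exp_pos _)]
  exact h3

/-- Every function bounded by a quadratic polynomial times the Gaussian decays. -/
theorem isDecaying_of_le_gauss {F : Type*} [NormedAddCommGroup F] [NormedSpace ℝ F] {s : ℝ}
    (hs : 0 < s)
    {K : V → F} (hK : Continuous K) {B : ℝ} (hB : 0 ≤ B)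
    (h : ∀ x, ‖K x‖ ≤ B * ((1 + ‖x‖) ^ 2 * gauss s x)) :
    IsDecaying K := by
  obtain ⟨C, hC, hb⟩ := exists_gauss_le (V := V) hs
  refine ⟨hK, B * C, by positivity, fun x => (h x).trans ?_⟩
  rw [mul_assoc]
  exact mul_le_mul_of_nonneg_left (hb x) hB

theorem isDecaying_gauss {s : ℝ} (hs : 0 < s) : IsDecaying (gauss s : V → ℝ) := by
  refine isDecaying_of_le_gauss hs (continuous_gauss s) (B := 1) zero_le_one
    fun x => by
      rw [Real.norm_of_nonneg (gauss_nonneg s x), one_mul]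
      exact le_mul_of_one_le_left (gauss_nonneg s x) (one_le_pow₀ (by simp))

variable [InnerProductSpace ℝ V]

variable (V) in
/-- The inner product as a bilinear map. -/
abbrev innerCLM : V →L[ℝ] V →L[ℝ] ℝ := innerSL ℝ

theorem innerCLM_apply (x y : V) : innerCLM V x y = inner ℝ x y := rfl

theorem norm_innerCLM_apply (x : V) : ‖innerCLM V x‖ = ‖x‖ := innerSL_apply_norm _ x

/-- The first derivative of the Gaussian. -/
def gaussDeriv (s : ℝ) (x : V) : V →L[ℝ] ℝ := (-2 * s * gauss s x) • innerCLM V x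

/-- The second derivative of the Gaussian. -/
def gaussDeriv₂ (s : ℝ) (x : V) : V →L[ℝ] V →L[ℝ] ℝ :=
  (-2 * s * gauss s x) • innerCLM V + ((-2 * s) • gaussDeriv s x).smulRight (innerCLM V x)

theorem continuous_gaussDeriv (s : ℝ) : Continuous (gaussDeriv s : V → V →L[ℝ] ℝ) := by
  have := continuous_gauss (V := V) s
  unfold gaussDeriv; fun_prop

theorem continuous_gaussDeriv₂ (s : ℝ) : Continuous (gaussDeriv₂ s : V → V →L[ℝ] V →L[ℝ] ℝ) := by
  have := continuous_gauss (V := V) s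
  have := continuous_gaussDeriv (V := V) s
  unfold gaussDeriv₂; fun_prop

theorem hasFDerivAt_gauss (s : ℝ) (x : V) : HasFDerivAt (gauss s) (gaussDeriv s x) x := by
  have h := (((hasStrictFDerivAt_norm_sq x).hasFDerivAt).const_mul (-s)).exp
  refine h.congr_fderiv ?_
  ext y
  simp [gaussDeriv, gauss, innerCLM_apply]
  ring

theorem hasFDerivAt_gaussDeriv (s : ℝ) (x : V) :
    HasFDerivAt (gaussDeriv s) (gaussDeriv₂ s x) x := by
  have h := ((hasFDerivAt_gauss s x).const_mul (-2 * s)).smul ((innerCLM V).hasFDerivAt (x := x))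
  exact h

theorem norm_gaussDeriv_le {s : ℝ} (hs : 0 < s) (x : V) :
    ‖gaussDeriv s x‖ ≤ 2 * s * (‖x‖ * gauss s x) := by
  rw [gaussDeriv, norm_smul, norm_innerCLM_apply, Real.norm_eq_abs, abs_mul,
    abs_of_nonneg (gauss_nonneg s x), abs_mul, abs_of_pos hs]
  norm_num
  exact le_of_eq (by ring)

theorem isDecaying_gaussDeriv {s : ℝ} (hs : 0 < s) : IsDecaying (gaussDeriv s : V → V →L[ℝ] ℝ) := by
  refine isDecaying_of_le_gauss hs (continuous_gaussDeriv s) (B := 2 * s)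
    (by positivity) fun x => by
      refine (norm_gaussDeriv_le hs x).trans ?_
      have := gauss_nonneg s x
      gcongr
      nlinarith [norm_nonneg x]

theorem isDecaying_gaussDeriv₂ {s : ℝ} (hs : 0 < s) :
    IsDecaying (gaussDeriv₂ s : V → V →L[ℝ] V →L[ℝ] ℝ) := by
  refine isDecaying_of_le_gauss hs (continuous_gaussDeriv₂ s) (B := 2 * s + 4 * s ^ 2)
    (by positivity) fun x => by
      have h0 := gauss_nonneg s x
      have hx := norm_nonneg x
      have hI : ‖innerCLM V‖ ≤ 1 := norm_innerSL_le _
      have h1 : ‖(-2 * s * gauss s x) • innerCLM V‖ ≤ 2 * s * gauss s x := by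
        rw [norm_smul, Real.norm_eq_abs, abs_mul, abs_of_nonneg h0, abs_mul, abs_of_pos hs]
        norm_num
        exact mul_le_of_le_one_right (by positivity) hI
      have h2 : ‖((-2 * s) • gaussDeriv s x).smulRight (innerCLM V x)‖
          ≤ 4 * s ^ 2 * (‖x‖ ^ 2 * gauss s x) := by
        rw [ContinuousLinearMap.norm_smulRight_apply, norm_smul, norm_innerCLM_apply,
          Real.norm_eq_abs, abs_mul, abs_of_pos hs]
        norm_num
        have := mul_le_mul_of_nonneg_left (norm_gaussDeriv_le hs x)
          (show 0 ≤ 2 * s * ‖x‖ by positivity)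
        nlinarith
      have h3 : gauss s x ≤ (1 + ‖x‖) ^ 2 * gauss s x :=
        le_mul_of_one_le_left h0 (one_le_pow₀ (by simp))
      have h4 : ‖x‖ ^ 2 * gauss s x ≤ (1 + ‖x‖) ^ 2 * gauss s x := by gcongr; simp
      calc ‖gaussDeriv₂ s x‖ ≤ 2 * s * gauss s x + 4 * s ^ 2 * (‖x‖ ^ 2 * gauss s x) :=
            (norm_add_le _ _).trans (add_le_add h1 h2)
        _ ≤ 2 * s * ((1 + ‖x‖) ^ 2 * gauss s x) + 4 * s ^ 2 * ((1 + ‖x‖) ^ 2 * gauss s x) := by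
            gcongr
        _ = _ := by ring

end Gaussian

/-! ### Convolution with the Gaussian -/

section Heat

variable {G : Plane → ℝ} {M : ℝ}

/-- The convolution of `G` with the unnormalised Gaussian. -/
def gaussConv (G : Plane → ℝ) (s : ℝ) (p : Plane) : ℝ := ∫ q, G q • gauss s (p - q)

theorem hasFDerivAt_gaussConv (hG : Continuous G) (hM : ∀ p, |G p| ≤ M) {s : ℝ} (hs : 0 < s)
    (p : Plane) : HasFDerivAt (gaussConv G s) (∫ q, G q • gaussDeriv s (p - q)) p :=
  (isDecaying_gauss hs).hasFDerivAt_convolution (isDecaying_gaussDeriv hs) (hasFDerivAt_gauss s)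
    hG hM p

theorem hasFDerivAt_gaussConv₂ (hG : Continuous G) (hM : ∀ p, |G p| ≤ M) {s : ℝ} (hs : 0 < s)
    (p : Plane) : HasFDerivAt (fun p => ∫ q, G q • gaussDeriv s (p - q))
      (∫ q, G q • gaussDeriv₂ s (p - q)) p :=
  (isDecaying_gaussDeriv hs).hasFDerivAt_convolution (isDecaying_gaussDeriv₂ hs)
    (hasFDerivAt_gaussDeriv s) hG hM p

theorem contDiff_gaussConv (hG : Continuous G) (hM : ∀ p, |G p| ≤ M) {s : ℝ} (hs : 0 < s) :
    ContDiff ℝ 2 (gaussConv G s) := by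
  have h1 : ContDiff ℝ 1 (fun p => ∫ q, G q • gaussDeriv s (p - q)) := by
    have := (contDiff_succ_iff_hasFDerivAt (𝕜 := ℝ) (n := 0)
      (f := fun p => ∫ q, G q • gaussDeriv s (p - q))).2
      ⟨_, contDiff_zero.2 ((isDecaying_gaussDeriv₂ hs).continuous_convolution hG hM),
        hasFDerivAt_gaussConv₂ hG hM hs⟩
    simpa using this
  have := (contDiff_succ_iff_hasFDerivAt (𝕜 := ℝ) (n := 1) (f := gaussConv G s)).2
      ⟨_, by exact_mod_cast h1, hasFDerivAt_gaussConv hG hM hs⟩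
  simpa [one_add_one_eq_two] using this

theorem laplacian_gaussConv (hG : Continuous G) (hM : ∀ p, |G p| ≤ M) {s : ℝ} (hs : 0 < s)
    (p : Plane) : Δ (gaussConv G s) p
      = ∫ q, G q * ((4 * s ^ 2 * ‖p - q‖ ^ 2 - 4 * s) * gauss s (p - q)) := by
  have hf : fderiv ℝ (gaussConv G s) = fun p => ∫ q, G q • gaussDeriv s (p - q) :=
    funext fun p => (hasFDerivAt_gaussConv hG hM hs p).fderiv
  have hi := (isDecaying_gaussDeriv₂ hs).integrable_smul hG hM p
  rw [InnerProductSpace.laplacian_eq_iteratedFDeriv_orthonormalBasis _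
    (EuclideanSpace.basisFun (Fin 2) ℝ)]
  have key : ∀ e : Plane, iteratedFDeriv ℝ 2 (gaussConv G s) p ![e, e]
      = ∫ q, G q * gaussDeriv₂ s (p - q) e e := by
    intro e
    rw [iteratedFDeriv_two_apply, hf, (hasFDerivAt_gaussConv₂ hG hM hs p).fderiv]
    simp only [Matrix.cons_val_zero, Matrix.cons_val_one]
    rw [ContinuousLinearMap.integral_apply hi, ContinuousLinearMap.integral_apply
      (hi.apply_continuousLinearMap e)]
    simp
  have hint : ∀ e : Plane, Integrable (fun q => G q * gaussDeriv₂ s (p - q) e e) := fun e => by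
    simpa using (hi.apply_continuousLinearMap e).apply_continuousLinearMap e
  simp only [key]
  rw [← integral_finsetSum _ fun i _ => hint _]
  refine integral_congr_ae (ae_of_all _ fun q => ?_)
  simp only [gaussDeriv₂, gaussDeriv, EuclideanSpace.basisFun_apply, Fin.sum_univ_two,
    EuclideanSpace.norm_sq_eq]
  simp [innerCLM_apply, EuclideanSpace.inner_single_right]
  ring

theorem hasDerivAt_gaussConv (hG : Continuous G) (hM : ∀ p, |G p| ≤ M) {s : ℝ} (hs : 0 < s)
    (p : Plane) : Integrable (fun q => G q * (-‖p - q‖ ^ 2 * gauss s (p - q))) ∧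
      HasDerivAt (fun s => gaussConv G s p) (∫ q, G q * (-‖p - q‖ ^ 2 * gauss s (p - q))) s := by
  have hdec : IsDecaying (fun x : Plane => ‖x‖ ^ 2 * gauss (s / 2) x) := by
    have hc := continuous_gauss (V := Plane) (s / 2)
    refine isDecaying_of_le_gauss (half_pos hs)
      (K := fun x : Plane => ‖x‖ ^ 2 * gauss (s / 2) x) (by fun_prop) (B := 1) zero_le_one
      fun x => by
        have := gauss_nonneg (s / 2) x
        rw [Real.norm_of_nonneg (by positivity), one_mul]
        gcongr
        simp
  have hbound : Integrable (fun q => M * (‖p - q‖ ^ 2 * gauss (s / 2) (p - q))) :=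
    (hdec.integrable_smul continuous_const (M := 1) (G := fun _ => 1) (by simp) p).const_mul M
      |>.congr (ae_of_all _ fun q => by simp)
  have hc := continuous_gauss (V := Plane)
  refine hasDerivAt_integral_of_dominated_loc_of_deriv_le (Ioi_mem_nhds (half_lt_self hs))
    (F := fun s q => G q • gauss s (p - q))
    (F' := fun s q => G q * (-‖p - q‖ ^ 2 * gauss s (p - q)))
    (Eventually.of_forall fun t => ?_) ((isDecaying_gauss hs).integrable_smul hG hM p) ?_
    (ae_of_all _ fun q t ht => ?_) hbound (ae_of_all _ fun q t ht => ?_)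
  · have := hc t; fun_prop
  · have := hc s; fun_prop
  · rw [norm_mul, norm_mul, norm_neg, Real.norm_of_nonneg (gauss_nonneg _ _), Real.norm_eq_abs,
      Real.norm_of_nonneg (by positivity)]
    have h1 : gauss t (p - q) ≤ gauss (s / 2) (p - q) := by
      refine Real.exp_le_exp.2 ?_
      have : s / 2 < t := ht
      nlinarith [sq_nonneg ‖p - q‖]
    have hM0 : 0 ≤ M := (abs_nonneg _).trans (hM q)
    have := gauss_nonneg t (p - q)
    have := hM q
    gcongr
  · have h := (((hasDerivAt_id t).neg.mul_const (‖p - q‖ ^ 2)).exp).const_mul (G q)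
    refine h.congr_deriv ?_
    simp only [gauss, id, Pi.neg_apply]
    ring

end Heat

/-! ### The heat flow -/

section HeatFlow

variable {G : Plane → ℝ} {M : ℝ}

/-- The heat flow started from `G`, multiplied by the total mass `4π` of the Gaussian. Written as an
average over displacements `√t • z`, it makes sense for `t = 0` too. -/
def heatFlow (G : Plane → ℝ) (p : Plane) (t : ℝ) : ℝ := ∫ z, G (p + √t • z) * gauss (1 / 4) z

/-- The total mass of the Gaussian that defines the heat flow. -/
def heatMass : ℝ := ∫ z : Plane, gauss (1 / 4) z

theorem integrable_gauss {s : ℝ} (hs : 0 < s) : Integrable (gauss s : Plane → ℝ) := by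
  have h := (isDecaying_gauss (V := Plane) hs).integrable_smul (G := fun _ => 1)
    continuous_const (M := 1) (by simp) 0
  simpa using h.comp_neg

theorem heatMass_pos : 0 < heatMass := by
  refine integral_pos_of_integrable_nonneg_nonzero (x := 0) (continuous_gauss _)
    (integrable_gauss (by norm_num)) (gauss_nonneg _) ?_
  simp [gauss]

theorem heatFlow_zero (p : Plane) : heatFlow G p 0 = heatMass * G p := by
  simp [heatFlow, heatMass, integral_const_mul, mul_comm]

theorem heatFlow_neg (p : Plane) (t : ℝ) : heatFlow (fun q => -G q) p t = -heatFlow G p t := by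
  simp [heatFlow, integral_neg]

theorem continuous_heatFlow (hG : Continuous G) (hM : ∀ p, |G p| ≤ M) :
    Continuous (fun x : Plane × ℝ => heatFlow G x.1 x.2) := by
  have hc := continuous_gauss (V := Plane) (1 / 4)
  refine continuous_of_dominated (bound := fun z => M * gauss (1 / 4) z)
    (fun x => by fun_prop) (fun x => ae_of_all _ fun z => ?_)
    ((integrable_gauss (by norm_num)).const_mul _) (ae_of_all _ fun z => by fun_prop)
  rw [norm_mul, Real.norm_of_nonneg (gauss_nonneg _ z)]
  exact mul_le_mul_of_nonneg_right (hM _) (gauss_nonneg _ z)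

/-- The heat flow is a convolution with a Gaussian, by the substitution `q = p + √t • z`. -/
theorem heatFlow_eq_gaussConv {t : ℝ} (ht : 0 < t) (p : Plane) :
    heatFlow G p t = t⁻¹ * gaussConv G (1 / (4 * t)) p := by
  have h0 : √t ≠ 0 := (Real.sqrt_pos.2 ht).ne'
  have h1 : heatFlow G p t
      = ∫ z : Plane, (fun y => G (p + y) * gauss (1 / (4 * t)) y) (√t • z) := by
    refine integral_congr_ae (ae_of_all _ fun z => ?_)
    simp only [gauss, norm_smul, mul_pow, Real.norm_eq_abs, sq_abs, Real.sq_sqrt ht.le]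
    congr 2
    field_simp
  rw [h1, Measure.integral_comp_smul volume (fun y => G (p + y) * gauss (1 / (4 * t)) y)]
  have h2 : ∫ y : Plane, G (p + y) * gauss (1 / (4 * t)) y = gaussConv G (1 / (4 * t)) p := by
    rw [gaussConv, ← integral_add_left_eq_self (fun q => G q • gauss (1 / (4 * t)) (p - q)) p]
    refine integral_congr_ae (ae_of_all _ fun z => ?_)
    simp [gauss]
  rw [h2]
  simp [Real.sq_sqrt ht.le, abs_of_pos ht]

theorem contDiff_heatFlow (hG : Continuous G) (hM : ∀ p, |G p| ≤ M) {t : ℝ} (ht : 0 < t) :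
    ContDiff ℝ 2 (fun p => heatFlow G p t) := by
  simp only [heatFlow_eq_gaussConv ht]
  exact contDiff_const.mul (contDiff_gaussConv hG hM (by positivity))

/-- The heat equation. -/
theorem hasDerivAt_heatFlow (hG : Continuous G) (hM : ∀ p, |G p| ≤ M) {t : ℝ} (ht : 0 < t)
    (p : Plane) : HasDerivAt (heatFlow G p) (Δ (fun p => heatFlow G p t) p) t := by
  set s := 1 / (4 * t) with hs
  have hs0 : 0 < s := by positivity
  obtain ⟨hi, hd⟩ := hasDerivAt_gaussConv hG hM hs0 p
  have hds : HasDerivAt (fun t : ℝ => 1 / (4 * t)) (-(1 / (4 * t ^ 2))) t := by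
    have h := ((hasDerivAt_id t).const_mul 4).inv (by simp [ht.ne'])
    simp only [one_div]
    refine h.congr_deriv ?_
    simp only [id]
    field_simp
  have h1 := (hasDerivAt_inv ht.ne').mul (HasDerivAt.comp t (h₂ := fun s => gaussConv G s p) hd hds)
  have h2 : Δ (fun p => heatFlow G p t) p = t⁻¹ * Δ (gaussConv G s) p := by
    have : (fun p => heatFlow G p t) = t⁻¹ • gaussConv G s :=
      funext fun p => heatFlow_eq_gaussConv ht p
    rw [this, InnerProductSpace.laplacian_smul _ (contDiff_gaussConv hG hM hs0).contDiffAt,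
      smul_eq_mul]
  rw [h2, laplacian_gaussConv hG hM hs0]
  refine (h1.congr_of_eventuallyEq ?_).congr_deriv ?_
  · filter_upwards [lt_mem_nhds ht] with r hr
    exact heatFlow_eq_gaussConv hr p
  · have hi0 : Integrable fun q => G q * gauss s (p - q) :=
      (isDecaying_gauss hs0).integrable_smul hG hM p
    have h3 : ∫ q, G q * ((4 * s ^ 2 * ‖p - q‖ ^ 2 - 4 * s) * gauss s (p - q))
        = -(4 * s ^ 2) * (∫ q, G q * (-‖p - q‖ ^ 2 * gauss s (p - q)))
          - 4 * s * gaussConv G s p := by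
      rw [gaussConv, ← integral_const_mul, ← integral_const_mul,
        ← integral_sub (hi.const_mul _) (by simpa using hi0.const_mul (4 * s))]
      refine integral_congr_ae (ae_of_all _ fun q => ?_)
      simp only [smul_eq_mul]
      ring
    rw [h3]
    simp only [Function.comp, ← hs]
    have h4 : s * t = 1 / 4 := by rw [hs]; field_simp
    generalize (∫ q, G q * (-‖p - q‖ ^ 2 * gauss s (p - q))) = A
    generalize gaussConv G s p = B
    have h5 : s = 1 / 4 * t⁻¹ := by rw [hs]; field_simp
    rw [h5]
    field_simp
    ring

/-- The heat flow inherits every oddness under an isometry. -/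
theorem heatFlow_odd {ρ : Plane ≃ᵃⁱ[ℝ] Plane} (hρ : ∀ q, G (ρ q) = -G q) (p : Plane) (t : ℝ) :
    heatFlow G (ρ p) t = -heatFlow G p t := by
  rw [← heatFlow_neg, heatFlow, heatFlow,
    ← ρ.linearIsometryEquiv.measurePreserving.integral_comp'
      (f := ρ.linearIsometryEquiv.toMeasurableEquiv)]
  refine integral_congr_ae (ae_of_all _ fun z => ?_)
  have h : ρ p + √t • ρ.linearIsometryEquiv z = ρ (p + √t • z) := by
    have := ρ.map_vadd p (√t • z)
    simp only [vadd_eq_add, map_smul] at this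
    rw [add_comm p, this, add_comm]
  simp [h, hρ, gauss]

end HeatFlow

/-! ### The parabolic maximum principle and the reflection principle -/

section MaximumPrinciple

theorem iteratedFDeriv_two_nonpos_of_isLocalMax {V : Type*} [NormedAddCommGroup V]
    [NormedSpace ℝ V] {f : V → ℝ} {p : V} (hf : ContDiffAt ℝ 2 f p) (hmax : IsLocalMax f p)
    (e : V) :
    iteratedFDeriv ℝ 2 f p ![e, e] ≤ 0 := by
  rw [iteratedFDeriv_two_apply]
  simp only [Matrix.cons_val_zero, Matrix.cons_val_one]
  set g : ℝ → ℝ := fun s => f (p + s • e) with hg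
  have hl : Continuous fun s : ℝ => p + s • e := by fun_prop
  have hl0 : Tendsto (fun s : ℝ => p + s • e) (𝓝 0) (𝓝 p) := by
    simpa using hl.tendsto 0
  have hdl : ∀ s : ℝ, HasDerivAt (fun s : ℝ => p + s • e) e s := fun s => by
    simpa using ((hasDerivAt_id s).smul_const e).const_add p
  have hdiff : ∀ᶠ q in 𝓝 p, DifferentiableAt ℝ f q := by
    filter_upwards [hf.eventually (by simp)] with q hq
    exact hq.differentiableAt (by norm_num)
  have hg1 : deriv g =ᶠ[𝓝 0] fun s => fderiv ℝ f (p + s • e) e := by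
    filter_upwards [hl0.eventually hdiff] with s hs
    exact (hs.hasFDerivAt.comp_hasDerivAt s (hdl s)).deriv
  have hg2 : deriv (deriv g) 0 = fderiv ℝ (fderiv ℝ f) p e e := by
    rw [hg1.deriv_eq]
    have h1 : HasFDerivAt (fderiv ℝ f) (fderiv ℝ (fderiv ℝ f) p) (p + (0 : ℝ) • e) := by
      have := (hf.fderiv_right (m := 1) (by norm_num)).differentiableAt (by norm_num)
      simpa using this.hasFDerivAt
    have h2 : HasDerivAt (fun s : ℝ => fderiv ℝ f (p + s • e)) (fderiv ℝ (fderiv ℝ f) p e) 0 :=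
      HasFDerivAt.comp_hasDerivAt (f := fun s : ℝ => p + s • e) 0 h1 (hdl 0)
    have h3 := h2.clm_apply (hasDerivAt_const (0 : ℝ) e)
    simpa using h3.deriv
  have hgmax : IsLocalMax g 0 := by
    have h : ∀ᶠ s in 𝓝 (0 : ℝ), f (p + s • e) ≤ f p := hl0.eventually hmax
    filter_upwards [h] with s hs
    simpa [hg] using hs
  by_contra! hpos
  have hgc : ContinuousAt g 0 := by
    have : ContinuousAt f (p + (0 : ℝ) • e) := by simpa using hf.continuousAt
    exact ContinuousAt.comp (f := fun s : ℝ => p + s • e) this hl.continuousAt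
  have hmin := isLocalMin_of_deriv_deriv_pos (hg2 ▸ hpos) hgmax.deriv_eq_zero hgc
  -- a point that is both a local maximum and a local minimum has vanishing derivatives
  have hconst : g =ᶠ[𝓝 0] fun _ => g 0 := by
    filter_upwards [hgmax, hmin] with s h1 h2
    exact le_antisymm h1 h2
  have h0 : deriv (deriv g) 0 = 0 := by
    rw [hconst.deriv.deriv_eq]
    simp
  rw [← hg2, h0] at hpos
  exact lt_irrefl _ hpos

theorem laplacian_nonpos_of_isLocalMax {f : Plane → ℝ} {p : Plane} (hf : ContDiffAt ℝ 2 f p)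
    (hmax : IsLocalMax f p) : Δ f p ≤ 0 := by
  rw [InnerProductSpace.laplacian_eq_iteratedFDeriv_orthonormalBasis _
    (EuclideanSpace.basisFun (Fin 2) ℝ)]
  exact Finset.sum_nonpos fun i _ => iteratedFDeriv_two_nonpos_of_isLocalMax hf hmax _

variable {G : Plane → ℝ} {M c : ℝ} {S U : Set Plane}

/-- One half of `heatFlow_eq_of_odd`, by the parabolic maximum principle: the difference of the two
sides, reduced by `ε t`, has a maximum on `S × [0, t]`; it cannot be positive, for at a positive
maximum the time derivative would exceed the Laplacian. -/
theorem heatFlow_le_of_odd (hG : Continuous G) (hM : ∀ p, |G p| ≤ M) (hS : IsCompact S)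
    (hU : IsOpen U) (hUS : U ⊆ S) (hG2 : ContDiffOn ℝ 2 G U) (hc : ∀ p ∈ U, Δ G p + c * G p = 0)
    (hodd : ∀ p ∈ S, p ∉ U → ∃ ρ : Plane ≃ᵃⁱ[ℝ] Plane, ρ p = p ∧ ∀ q, G (ρ q) = -G q)
    {p : Plane} (hp : p ∈ S) {t : ℝ} (ht : 0 ≤ t) :
    heatFlow G p t ≤ heatMass * Real.exp (-c * t) * G p := by
  by_contra! hlt
  set v : Plane × ℝ → ℝ :=
    fun x => heatFlow G x.1 x.2 - heatMass * Real.exp (-c * x.2) * G x.1 with hv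
  have hvpos : 0 < v (p, t) := sub_pos.2 hlt
  set ε := v (p, t) / (2 * (t + 1)) with hε
  have hε0 : 0 < ε := by positivity
  have hεt : ε * t < v (p, t) := by
    rw [hε, div_mul_eq_mul_div, div_lt_iff₀ (by positivity)]
    nlinarith
  have hvc : Continuous v := by
    have := continuous_heatFlow hG hM
    fun_prop
  obtain ⟨⟨p0, t0⟩, ⟨hp0, ht0⟩, hmax⟩ := (hS.prod (isCompact_Icc (a := 0) (b := t))).exists_isMaxOn
    ⟨(p, t), hp, Set.right_mem_Icc.2 ht⟩
    (f := fun x => v x - ε * x.2) (by fun_prop)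
  have hmax' : ∀ q ∈ S, ∀ r, 0 ≤ r → r ≤ t → v (q, r) - ε * r ≤ v (p0, t0) - ε * t0 :=
    fun q hq r h0 h1 => hmax (show (q, r) ∈ S ×ˢ Set.Icc 0 t from ⟨hq, h0, h1⟩)
  simp only at hp0 ht0
  have hpos : 0 < v (p0, t0) - ε * t0 := lt_of_lt_of_le (by linarith) (hmax' p hp t ht le_rfl)
  have ht0pos : 0 < t0 := by
    refine lt_of_le_of_ne ht0.1 fun h => ?_
    subst h
    simp [hv, heatFlow_zero] at hpos
  have hp0U : p0 ∈ U := by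
    by_contra hn
    obtain ⟨ρ, hρ, hGρ⟩ := hodd p0 hp0 hn
    have h1 := heatFlow_odd hGρ p0 t0
    have h2 := hGρ p0
    rw [hρ] at h1 h2
    have h3 : heatFlow G p0 t0 = 0 := by linarith
    have h4 : G p0 = 0 := by linarith
    simp only [hv, h3, h4] at hpos
    nlinarith
  have hGd : ContDiffAt ℝ 2 G p0 := hG2.contDiffAt (hU.mem_nhds hp0U)
  set k := heatMass * Real.exp (-c * t0) with hk
  have hW := (contDiff_heatFlow hG hM ht0pos).contDiffAt (x := p0)
  have hlap : Δ (fun q => heatFlow G q t0) p0 - k * Δ G p0 ≤ 0 := by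
    have h1 : Δ ((fun q => heatFlow G q t0) - k • G) p0
        = Δ (fun q => heatFlow G q t0) p0 - k * Δ G p0 := by
      rw [hW.laplacian_sub (f₂ := k • G) (hGd.const_smul k),
        InnerProductSpace.laplacian_smul k hGd, smul_eq_mul]
    rw [← h1]
    refine laplacian_nonpos_of_isLocalMax (hW.sub (hGd.const_smul k)) ?_
    filter_upwards [hU.mem_nhds hp0U] with q hq
    have := hmax' q (hUS hq) t0 ht0.1 ht0.2
    simp only [hv, ← hk] at this
    simp only [Pi.sub_apply, Pi.smul_apply, smul_eq_mul]
    linarith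
  have htime : HasDerivAt (fun r => v (p0, r) - ε * r)
      (Δ (fun q => heatFlow G q t0) p0 + c * k * G p0 - ε) t0 := by
    have h1 : HasDerivAt (fun r => heatMass * Real.exp (-c * r) * G p0) (-(c * k * G p0)) t0 := by
      have := ((((hasDerivAt_id t0).const_mul (-c)).exp).const_mul heatMass).mul_const (G p0)
      refine this.congr_deriv ?_
      simp only [hk, id]
      ring
    refine (((hasDerivAt_heatFlow hG hM ht0pos p0).sub h1).sub
      ((hasDerivAt_id t0).const_mul ε)).congr_deriv ?_
    ring
  -- the maximum over earlier times gives a nonnegative left derivative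
  have hle : 0 ≤ Δ (fun q => heatFlow G q t0) p0 + c * k * G p0 - ε := by
    refine ge_of_tendsto (htime.tendsto_slope.mono_left
      (nhdsWithin_mono _ (show Set.Iio t0 ⊆ {t0}ᶜ from fun r hr => ne_of_lt hr))) ?_
    filter_upwards [Ioo_mem_nhdsLT ht0pos] with r hr
    have := hmax' p0 hp0 r hr.1.le (hr.2.le.trans ht0.2)
    rw [slope_def_field]
    exact div_nonneg_of_nonpos (by linarith) (by linarith [hr.2])
  have := hc p0 hp0U
  have h5 : Δ G p0 = -(c * G p0) := by linarith
  rw [h5] at hlap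
  linarith

/-- If `G` solves the Helmholtz equation in `U` and every point of the compact set `S` outside `U`
is fixed by an isometry under which `G` is odd, then on `S` the heat flow only damps `G`. -/
theorem heatFlow_eq_of_odd (hG : Continuous G) (hM : ∀ p, |G p| ≤ M) (hS : IsCompact S)
    (hU : IsOpen U) (hUS : U ⊆ S) (hG2 : ContDiffOn ℝ 2 G U) (hc : ∀ p ∈ U, Δ G p + c * G p = 0)
    (hodd : ∀ p ∈ S, p ∉ U → ∃ ρ : Plane ≃ᵃⁱ[ℝ] Plane, ρ p = p ∧ ∀ q, G (ρ q) = -G q)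
    {p : Plane} (hp : p ∈ S) {t : ℝ} (ht : 0 ≤ t) :
    heatFlow G p t = heatMass * Real.exp (-c * t) * G p := by
  refine le_antisymm (heatFlow_le_of_odd hG hM hS hU hUS hG2 hc hodd hp ht) ?_
  have h := heatFlow_le_of_odd (G := fun q => -G q) hG.neg (M := M) (c := c) (by simpa using hM)
    hS hU hUS hG2.neg (fun p hp => ?_) (fun p hp hn => ?_) hp ht
  · rw [heatFlow_neg] at h
    linarith
  · have h1 : Δ (fun q => -G q) p = -Δ G p := by
      have := InnerProductSpace.laplacian_neg (f := G)
      exact congrFun this p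
    rw [h1]
    linarith [hc p hp]
  · obtain ⟨ρ, h1, h2⟩ := hodd p hp hn
    exact ⟨ρ, h1, fun q => by rw [h2]⟩

/-- A function that the heat flow only damps is smooth and solves the Helmholtz equation, up to
and across the boundary of the set on which this holds. -/
theorem exists_contDiff_of_heatFlow_eq (hG : Continuous G) (hM : ∀ p, |G p| ≤ M)
    (h : ∀ p ∈ S, ∀ t, 0 ≤ t → heatFlow G p t = heatMass * Real.exp (-c * t) * G p) :
    ∃ g : Plane → ℝ, ContDiff ℝ 2 g ∧ Set.EqOn g G S ∧ ∀ p ∈ S, Δ g p + c * g p = 0 := by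
  set k := heatMass * Real.exp (-c * 1) with hk
  have hk0 : k ≠ 0 := (mul_pos heatMass_pos (Real.exp_pos _)).ne'
  have hW := contDiff_heatFlow hG hM one_pos
  have hval : ∀ p ∈ S, heatFlow G p 1 = k * G p := fun p hp => h p hp 1 zero_le_one
  refine ⟨k⁻¹ • fun p => heatFlow G p 1, contDiff_const.smul hW, fun p hp => ?_, fun p hp => ?_⟩
  · simp [hval p hp, hk0]
  · rw [InnerProductSpace.laplacian_smul _ hW.contDiffAt]
    have h1 : HasDerivAt (fun t => heatMass * Real.exp (-c * t) * G p) (-(c * k * G p)) 1 := by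
      have := ((((hasDerivAt_id (1 : ℝ)).const_mul (-c)).exp).const_mul heatMass).mul_const (G p)
      refine this.congr_deriv ?_
      simp only [hk, id]
      ring
    have h2 := h1.congr_of_eventuallyEq (f₁ := heatFlow G p) (by
      filter_upwards [lt_mem_nhds one_pos] with t ht
      exact h p hp t ht.le)
    rw [(hasDerivAt_heatFlow hG hM one_pos p).unique h2]
    simp only [Pi.smul_apply, smul_eq_mul, hval p hp]
    ring

end MaximumPrinciple

/-! ### Odd periodic extension in oblique coordinates -/

section Lattice

variable {φ : ℝ × ℝ → ℝ} {M : ℝ}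

/-- The sum of `φ` over the six rotations about the origin. In the oblique coordinates used here,
the rotation by 60 degrees is `(a, b) ↦ (a + b, -a)`. -/
def hexSum (φ : ℝ × ℝ → ℝ) (x : ℝ × ℝ) : ℝ :=
  φ (x.1, x.2) + φ (x.1 + x.2, -x.1) + φ (x.2, -x.1 - x.2) + φ (-x.1, -x.2) +
    φ (-x.1 - x.2, x.1) + φ (-x.2, x.1 + x.2)

/-- The translate of `x` by the lattice vector with index `n`. The lattice consists of the integral
vectors whose two coordinates are congruent modulo three. -/
def latticeShift (n : ℤ × ℤ) (x : ℝ × ℝ) : ℝ × ℝ :=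
  (x.1 + (n.1 - n.2 : ℤ), x.2 + (n.1 + 2 * n.2 : ℤ))

/-- The sum of `hexSum φ` over the lattice. -/
def latticeSum (φ : ℝ × ℝ → ℝ) (x : ℝ × ℝ) : ℝ := ∑ᶠ n : ℤ × ℤ, hexSum φ (latticeShift n x)

/-- `φ` lives in the open triangle with vertices `(0, 0)`, `(1, 0)`, `(0, 1)`. -/
def IsTriangleSupported (φ : ℝ × ℝ → ℝ) : Prop :=
  ∀ x, φ x ≠ 0 → 0 < x.1 ∧ 0 < x.2 ∧ x.1 + x.2 < 1

theorem hexSum_rot (x : ℝ × ℝ) : hexSum φ (x.1 + x.2, -x.1) = hexSum φ x := by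
  simp only [hexSum]
  ring_nf

theorem hexSum_swap (hφ : ∀ a b, φ (b, a) = -φ (a, b)) (x : ℝ × ℝ) :
    hexSum φ x.swap = -hexSum φ x := by
  simp only [hexSum, Prod.fst_swap, Prod.snd_swap]
  rw [hφ x.1 x.2, ← neg_eq_iff_eq_neg.2 (hφ (x.1 + x.2) (-x.1)),
    ← neg_eq_iff_eq_neg.2 (hφ x.2 (-x.1 - x.2)), ← neg_eq_iff_eq_neg.2 (hφ (-x.1) (-x.2)),
    ← neg_eq_iff_eq_neg.2 (hφ (-x.1 - x.2) x.1), ← neg_eq_iff_eq_neg.2 (hφ (-x.2) (x.1 + x.2))]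
  ring_nf

/-- The six rotated triangles form a hexagon. -/
theorem hexSum_support (hφ : IsTriangleSupported φ) {x : ℝ × ℝ} (hx : hexSum φ x ≠ 0) :
    |x.1| < 1 ∧ |x.2| < 1 ∧ |x.1 + x.2| < 1 := by
  by_contra hn
  have h : ∀ y : ℝ × ℝ, (0 < y.1 → 0 < y.2 → y.1 + y.2 < 1 →
      |x.1| < 1 ∧ |x.2| < 1 ∧ |x.1 + x.2| < 1) → φ y = 0 := fun y hy => by
    by_contra h0
    exact hn (hy (hφ y h0).1 (hφ y h0).2.1 (hφ y h0).2.2)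
  refine hx ?_
  rw [hexSum, h, h, h, h, h, h]
  · norm_num
  all_goals
    intro h1 h2 h3
    simp only [abs_lt] at *
    refine ⟨⟨?_, ?_⟩, ⟨?_, ?_⟩, ?_, ?_⟩ <;> linarith

/-- The translates of the open hexagon by the lattice are disjoint. -/
theorem lattice_disjoint {m n : ℤ × ℤ} {x : ℝ × ℝ}
    (hm : |(latticeShift m x).1| < 1 ∧ |(latticeShift m x).2| < 1 ∧
      |(latticeShift m x).1 + (latticeShift m x).2| < 1)
    (hn : |(latticeShift n x).1| < 1 ∧ |(latticeShift n x).2| < 1 ∧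
      |(latticeShift n x).1 + (latticeShift n x).2| < 1) : m = n := by
  simp only [latticeShift, abs_lt] at hm hn
  obtain ⟨⟨h1, h2⟩, ⟨h3, h4⟩, h5, h6⟩ := hm
  obtain ⟨⟨k1, k2⟩, ⟨k3, k4⟩, k5, k6⟩ := hn
  have a1 : (m.1 - m.2) - (n.1 - n.2) < 2 := by
    have : ((m.1 - m.2 : ℤ) : ℝ) - (n.1 - n.2 : ℤ) < 2 := by linarith
    exact_mod_cast this
  have a2 : -2 < (m.1 - m.2) - (n.1 - n.2) := by
    have : -2 < ((m.1 - m.2 : ℤ) : ℝ) - (n.1 - n.2 : ℤ) := by linarith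
    exact_mod_cast this
  have a3 : (m.1 + 2 * m.2) - (n.1 + 2 * n.2) < 2 := by
    have : ((m.1 + 2 * m.2 : ℤ) : ℝ) - (n.1 + 2 * n.2 : ℤ) < 2 := by linarith
    exact_mod_cast this
  have a4 : -2 < (m.1 + 2 * m.2) - (n.1 + 2 * n.2) := by
    have : -2 < ((m.1 + 2 * m.2 : ℤ) : ℝ) - (n.1 + 2 * n.2 : ℤ) := by linarith
    exact_mod_cast this
  have a5 : (m.1 - m.2) + (m.1 + 2 * m.2) - ((n.1 - n.2) + (n.1 + 2 * n.2)) < 2 := by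
    have : ((m.1 - m.2 : ℤ) : ℝ) + (m.1 + 2 * m.2 : ℤ) - ((n.1 - n.2 : ℤ) + (n.1 + 2 * n.2 : ℤ))
      < 2 := by linarith
    exact_mod_cast this
  have a6 : -2 < (m.1 - m.2) + (m.1 + 2 * m.2) - ((n.1 - n.2) + (n.1 + 2 * n.2)) := by
    have : -2 < ((m.1 - m.2 : ℤ) : ℝ) + (m.1 + 2 * m.2 : ℤ)
      - ((n.1 - n.2 : ℤ) + (n.1 + 2 * n.2 : ℤ)) := by linarith
    exact_mod_cast this
  ext <;> omega

theorem latticeSum_eq (hφ : IsTriangleSupported φ) {x : ℝ × ℝ} {n : ℤ × ℤ}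
    (hn : hexSum φ (latticeShift n x) ≠ 0) : latticeSum φ x = hexSum φ (latticeShift n x) := by
  refine finsum_eq_single _ n fun m hm => ?_
  by_contra h
  exact hm (lattice_disjoint (hexSum_support hφ h) (hexSum_support hφ hn))

theorem abs_latticeSum_le (hφ : IsTriangleSupported φ) (hM : ∀ x, |φ x| ≤ M) (x : ℝ × ℝ) :
    |latticeSum φ x| ≤ 6 * M := by
  have hM0 : 0 ≤ M := (abs_nonneg _).trans (hM 0)
  by_cases h : ∃ n, hexSum φ (latticeShift n x) ≠ 0
  · obtain ⟨n, hn⟩ := h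
    rw [latticeSum_eq hφ hn, hexSum]
    generalize latticeShift n x = y
    have h1 := abs_le.1 (hM (y.1, y.2))
    have h2 := abs_le.1 (hM (y.1 + y.2, -y.1))
    have h3 := abs_le.1 (hM (y.2, -y.1 - y.2))
    have h4 := abs_le.1 (hM (-y.1, -y.2))
    have h5 := abs_le.1 (hM (-y.1 - y.2, y.1))
    have h6 := abs_le.1 (hM (-y.2, y.1 + y.2))
    rw [abs_le]
    constructor <;>
      linarith [h1.1, h1.2, h2.1, h2.2, h3.1, h3.2, h4.1, h4.2, h5.1, h5.2, h6.1, h6.2]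
  · push Not at h
    simp only [latticeSum, h, finsum_zero, abs_zero]
    positivity

theorem continuous_hexSum (hc : Continuous φ) : Continuous (hexSum φ) := by
  unfold hexSum
  fun_prop

theorem continuous_latticeSum (hφ : IsTriangleSupported φ) (hc : Continuous φ) :
    Continuous (latticeSum φ) := by
  refine continuous_finsum (fun n => (continuous_hexSum hc).comp ?_) fun x => ?_
  · unfold latticeShift
    fun_prop
  · refine ⟨Metric.ball x 1, Metric.ball_mem_nhds _ one_pos, ?_⟩
    -- three times the index of a translate that meets the ball is bounded by its vector
    obtain ⟨N, hN⟩ := exists_nat_gt (|x.1| + |x.2| + 2)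
    refine Set.Finite.subset (Set.finite_Icc ((-(3 * N : ℤ), -(3 * N : ℤ)) : ℤ × ℤ)
      (3 * N, 3 * N)) ?_
    rintro n ⟨y, hy, hyx⟩
    obtain ⟨h1, h2, -⟩ := hexSum_support hφ hy
    rw [Metric.mem_ball, Prod.dist_eq, max_lt_iff, Real.dist_eq, Real.dist_eq] at hyx
    simp only [latticeShift] at h1 h2
    have hx1 := neg_abs_le x.1
    have hx2 := neg_abs_le x.2
    have hx3 := le_abs_self x.1
    have hx4 := le_abs_self x.2
    have hx5 := abs_nonneg x.1
    have hx6 := abs_nonneg x.2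
    simp only [abs_lt] at h1 h2 hyx
    have b1 : (n.1 - n.2 : ℤ) < (N : ℤ) := by
      have : ((n.1 - n.2 : ℤ) : ℝ) < N := by linarith
      exact_mod_cast this
    have b2 : -(N : ℤ) < (n.1 - n.2 : ℤ) := by
      have : -(N : ℝ) < ((n.1 - n.2 : ℤ) : ℝ) := by linarith
      exact_mod_cast this
    have b3 : (n.1 + 2 * n.2 : ℤ) < (N : ℤ) := by
      have : ((n.1 + 2 * n.2 : ℤ) : ℝ) < N := by linarith
      exact_mod_cast this
    have b4 : -(N : ℤ) < (n.1 + 2 * n.2 : ℤ) := by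
      have : -(N : ℝ) < ((n.1 + 2 * n.2 : ℤ) : ℝ) := by linarith
      exact_mod_cast this
    refine ⟨⟨?_, ?_⟩, ?_, ?_⟩ <;> simp only <;> omega

/-- On the closed triangle only the term of the trivial translation and rotation survives. -/
theorem latticeSum_eq_self (hφ : IsTriangleSupported φ) {x : ℝ × ℝ} (h1 : 0 ≤ x.1) (h2 : 0 ≤ x.2)
    (h3 : x.1 + x.2 ≤ 1) : latticeSum φ x = φ x := by
  have hz : ∀ y : ℝ × ℝ, (0 < y.1 → 0 < y.2 → y.1 + y.2 < 1 → False) → φ y = 0 :=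
    fun y hy => by
      by_contra h0
      exact hy (hφ y h0).1 (hφ y h0).2.1 (hφ y h0).2.2
  have h0 : hexSum φ (latticeShift 0 x) = φ x := by
    have hx : latticeShift 0 x = x := by simp [latticeShift]
    rw [hx, hexSum, hz (x.1 + x.2, -x.1), hz (x.2, -x.1 - x.2), hz (-x.1, -x.2),
      hz (-x.1 - x.2, x.1), hz (-x.2, x.1 + x.2)]
    · simp
    all_goals
      intro k1 k2 k3
      simp only at k1 k2 k3
      linarith
  rw [← h0]
  refine finsum_eq_single _ 0 fun n hn => ?_
  by_contra hne
  obtain ⟨k1, k2, k3⟩ := hexSum_support hφ hne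
  simp only [latticeShift, abs_lt] at k1 k2 k3
  have a1 : (n.1 - n.2 : ℤ) < 1 := by
    have : ((n.1 - n.2 : ℤ) : ℝ) < 1 := by linarith
    exact_mod_cast this
  have a2 : -2 < (n.1 - n.2 : ℤ) := by
    have : -2 < ((n.1 - n.2 : ℤ) : ℝ) := by linarith
    exact_mod_cast this
  have a3 : (n.1 + 2 * n.2 : ℤ) < 1 := by
    have : ((n.1 + 2 * n.2 : ℤ) : ℝ) < 1 := by linarith
    exact_mod_cast this
  have a4 : -2 < (n.1 + 2 * n.2 : ℤ) := by
    have : -2 < ((n.1 + 2 * n.2 : ℤ) : ℝ) := by linarith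
    exact_mod_cast this
  have a5 : -2 < (n.1 - n.2 : ℤ) + (n.1 + 2 * n.2 : ℤ) := by
    have : -2 < ((n.1 - n.2 : ℤ) : ℝ) + (n.1 + 2 * n.2 : ℤ) := by linarith
    exact_mod_cast this
  exact hn (by ext <;> simp only [Prod.fst_zero, Prod.snd_zero] <;> omega)

theorem latticeSum_rot (x : ℝ × ℝ) : latticeSum φ (x.1 + x.2, -x.1) = latticeSum φ x := by
  let e : ℤ × ℤ ≃ ℤ × ℤ :=
    ⟨fun n => (n.1 + n.2, -n.1), fun n => (-n.2, n.1 + n.2), fun n => by ext <;> simp,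
      fun n => by ext <;> simp⟩
  rw [latticeSum, latticeSum, ← finsum_comp_equiv e]
  refine finsum_congr fun n => ?_
  rw [← hexSum_rot (latticeShift n x)]
  congr 1
  ext
  · simp [latticeShift, e]; ring
  · simp [latticeShift, e]; ring

theorem latticeSum_swap (hφ : ∀ a b, φ (b, a) = -φ (a, b)) (x : ℝ × ℝ) :
    latticeSum φ x.swap = -latticeSum φ x := by
  let e : ℤ × ℤ ≃ ℤ × ℤ :=
    ⟨fun n => (n.1 + n.2, -n.2), fun n => (n.1 + n.2, -n.2), fun n => by ext <;> simp,
      fun n => by ext <;> simp⟩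
  rw [latticeSum, latticeSum, ← finsum_neg_distrib, ← finsum_comp_equiv e]
  refine finsum_congr fun n => ?_
  rw [← hexSum_swap hφ]
  congr 1
  ext
  · simp [latticeShift, e]; ring
  · simp [latticeShift, e]; ring

theorem latticeSum_add_one (x : ℝ × ℝ) : latticeSum φ (x.1 + 1, x.2 + 1) = latticeSum φ x := by
  let e : ℤ × ℤ ≃ ℤ × ℤ :=
    ⟨fun n => (n.1 - 1, n.2), fun n => (n.1 + 1, n.2), fun n => by ext <;> simp,
      fun n => by ext <;> simp⟩
  rw [latticeSum, latticeSum, ← finsum_comp_equiv e]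
  refine finsum_congr fun n => ?_
  congr 1
  ext
  · simp [latticeShift, e]; ring
  · simp [latticeShift, e]; ring

theorem latticeSum_neg (x : ℝ × ℝ) : latticeSum φ (-x.1, -x.2) = latticeSum φ x := by
  rw [← latticeSum_rot x, ← latticeSum_rot (x.1 + x.2, -x.1),
    ← latticeSum_rot (_ + _, _)]
  congr 1
  ext <;> simp

/-- The reflections in the sides of the triangle are compositions of the swap of the coordinates
with rotations and translations. -/
theorem latticeSum_reflect₁ (hφ : ∀ a b, φ (b, a) = -φ (a, b)) (a b : ℝ) :
    latticeSum φ (-a, a + b) = -latticeSum φ (a, b) := by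
  rw [← latticeSum_rot (a, b), ← latticeSum_swap hφ]
  rfl

theorem latticeSum_reflect₂ (hφ : ∀ a b, φ (b, a) = -φ (a, b)) (a b : ℝ) :
    latticeSum φ (1 - b, 1 - a) = -latticeSum φ (a, b) := by
  rw [← latticeSum_swap hφ, ← latticeSum_neg, ← latticeSum_add_one]
  simp [sub_eq_neg_add]

end Lattice

/-! ### The triangles in barycentric coordinates -/

section Barycentric

/-- The barycentric coordinate that is one at the vertex `(1, 0)`. -/
def baryU (p : Plane) : ℝ := (1 + 2 * p 0) / 3

/-- The barycentric coordinate that is one at the vertex `(-1/2, √3/2)`. -/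
def baryV (p : Plane) : ℝ := (1 - p 0 + √3 * p 1) / 3

/-- The barycentric coordinate that is one at the vertex `(-1/2, -√3/2)`. -/
def baryW (p : Plane) : ℝ := (1 - p 0 - √3 * p 1) / 3

/-- The point with given second and third barycentric coordinates. -/
def ofBary (x : ℝ × ℝ) : Plane := !₂[1 - 3 / 2 * (x.1 + x.2), √3 / 2 * (x.1 - x.2)]

theorem sqrt_three_mul_self : √3 * √3 = 3 := Real.mul_self_sqrt (by norm_num)

theorem bary_sum (p : Plane) : baryU p + baryV p + baryW p = 1 := by
  simp only [baryU, baryV, baryW]; ring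

@[fun_prop]
theorem continuous_baryU : Continuous baryU := by unfold baryU; fun_prop

@[fun_prop]
theorem continuous_baryV : Continuous baryV := by unfold baryV; fun_prop

@[fun_prop]
theorem continuous_baryW : Continuous baryW := by unfold baryW; fun_prop

@[fun_prop]
theorem continuous_ofBary : Continuous ofBary := by
  unfold ofBary
  refine (PiLp.continuous_toLp 2 _).comp (continuous_pi fun i => ?_)
  fin_cases i <;> simp <;> fun_prop

theorem ofBary_bary (p : Plane) : ofBary (baryV p, baryW p) = p := by
  have h := sqrt_three_mul_self
  ext i
  fin_cases i
  · simp [ofBary, baryV, baryW]; ring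
  · simp [ofBary, baryV, baryW]; linear_combination (p 1 / 3) * h

theorem baryV_ofBary (x : ℝ × ℝ) : baryV (ofBary x) = x.1 := by
  simp [ofBary, baryV]; linear_combination (x.1 - x.2) / 6 * sqrt_three_mul_self

theorem baryW_ofBary (x : ℝ × ℝ) : baryW (ofBary x) = x.2 := by
  simp [ofBary, baryW]; linear_combination (x.2 - x.1) / 6 * sqrt_three_mul_self

theorem mem_convexHull_triple {a b c p : Plane} : p ∈ convexHull ℝ {a, b, c} ↔
    ∃ α β γ : ℝ, 0 ≤ α ∧ 0 ≤ β ∧ 0 ≤ γ ∧ α + β + γ = 1 ∧ α • a + β • b + γ • c = p := by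
  rw [convexHull_insert (by simp), convexHull_pair, mem_convexJoin]
  constructor
  · rintro ⟨x, hx, y, ⟨s, t, hs, ht, hst, rfl⟩, ⟨α, r, hα, hr, hαr, rfl⟩⟩
    rw [Set.mem_singleton_iff.1 hx]
    refine ⟨α, r * s, r * t, hα, by positivity, by positivity, ?_, ?_⟩
    · rw [add_assoc, ← mul_add, hst, mul_one, hαr]
    · module
  · rintro ⟨α, β, γ, hα, hβ, hγ, hs, rfl⟩
    refine ⟨a, rfl, ?_⟩
    rcases eq_or_lt_of_le (add_nonneg hβ hγ) with h | h
    · have h1 : β = 0 := by linarith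
      have h2 : γ = 0 := by linarith
      have h3 : α = 1 := by linarith
      subst h1 h2 h3
      exact ⟨b, left_mem_segment ℝ b c, by simpa using left_mem_segment ℝ a b⟩
    · refine ⟨(β / (β + γ)) • b + (γ / (β + γ)) • c, ⟨_, _, by positivity, by positivity, ?_, rfl⟩,
        α, β + γ, hα, h.le, by linarith, ?_⟩
      · field_simp
      · rw [smul_add, smul_smul, smul_smul, mul_div_cancel₀ _ h.ne', mul_div_cancel₀ _ h.ne',
          add_assoc]

/-- The lower half of the triangle. -/
def lowerHalf : Set Plane := convexHull ℝ {!₂[(1 : ℝ), 0], !₂[-1 / 2, 0], !₂[-1 / 2, -√3 / 2]}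

/-- The image of the lower half of the triangle under `T`, a sixth of the triangle. -/
def sixth : Set Plane := convexHull ℝ {!₂[(1 : ℝ), 0], !₂[1 / 4, √3 / 4], !₂[0, 0]}

theorem mem_triangle {p : Plane} : p ∈ triangle ↔ 0 ≤ baryU p ∧ 0 ≤ baryV p ∧ 0 ≤ baryW p := by
  have h := sqrt_three_mul_self
  rw [triangle, mem_convexHull_triple]
  constructor
  · rintro ⟨α, β, γ, hα, hβ, hγ, hs, rfl⟩
    have h1 : baryU (α • !₂[(1 : ℝ), 0] + β • !₂[-1 / 2, √3 / 2] + γ • !₂[-1 / 2, -√3 / 2])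
        = α := by
      simp [baryU]; linear_combination -hs / 3
    have h2 : baryV (α • !₂[(1 : ℝ), 0] + β • !₂[-1 / 2, √3 / 2] + γ • !₂[-1 / 2, -√3 / 2])
        = β := by
      simp [baryV]; linear_combination (β - γ) / 6 * h - hs / 3
    have h3 : baryW (α • !₂[(1 : ℝ), 0] + β • !₂[-1 / 2, √3 / 2] + γ • !₂[-1 / 2, -√3 / 2])
        = γ := by
      simp [baryW]; linear_combination (γ - β) / 6 * h - hs / 3
    rw [h1, h2, h3]
    exact ⟨hα, hβ, hγ⟩
  · rintro ⟨h1, h2, h3⟩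
    refine ⟨_, _, _, h1, h2, h3, bary_sum p, ?_⟩
    ext i
    fin_cases i
    · simp [baryU, baryV, baryW]; ring
    · simp [baryU, baryV, baryW]; linear_combination (p 1 / 3) * h

theorem mem_lowerHalf {p : Plane} :
    p ∈ lowerHalf ↔ 0 ≤ baryU p ∧ 0 ≤ baryV p ∧ baryV p ≤ baryW p := by
  have h := sqrt_three_mul_self
  rw [lowerHalf, mem_convexHull_triple]
  constructor
  · rintro ⟨α, β, γ, hα, hβ, hγ, hs, rfl⟩
    have h1 : baryU (α • !₂[(1 : ℝ), 0] + β • !₂[-1 / 2, 0] + γ • !₂[-1 / 2, -√3 / 2]) = α := by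
      simp [baryU]; linear_combination -hs / 3
    have h2 : baryV (α • !₂[(1 : ℝ), 0] + β • !₂[-1 / 2, 0] + γ • !₂[-1 / 2, -√3 / 2]) = β / 2 := by
      simp [baryV]; linear_combination -γ / 6 * h - hs / 3
    have h3 : baryW (α • !₂[(1 : ℝ), 0] + β • !₂[-1 / 2, 0] + γ • !₂[-1 / 2, -√3 / 2])
        = β / 2 + γ := by
      simp [baryW]; linear_combination γ / 6 * h - hs / 3
    rw [h1, h2, h3]
    exact ⟨hα, by linarith, by linarith⟩
  · rintro ⟨h1, h2, h3⟩
    refine ⟨baryU p, 2 * baryV p, baryW p - baryV p, h1, by linarith, by linarith, ?_, ?_⟩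
    · linear_combination bary_sum p
    ext i
    fin_cases i
    · simp [baryU, baryV, baryW]; ring
    · simp [baryV, baryW]; linear_combination (p 1 / 3) * h

theorem mem_sixth {p : Plane} :
    p ∈ sixth ↔ baryV p ≤ baryU p ∧ baryW p ≤ baryV p ∧ 0 ≤ baryW p := by
  have h := sqrt_three_mul_self
  rw [sixth, mem_convexHull_triple]
  constructor
  · rintro ⟨α, β, γ, hα, hβ, hγ, hs, rfl⟩
    have h1 : baryU (α • !₂[(1 : ℝ), 0] + β • !₂[1 / 4, √3 / 4] + γ • !₂[0, 0])
        = α + β / 2 + γ / 3 := by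
      simp [baryU]; linear_combination -hs / 3
    have h2 : baryV (α • !₂[(1 : ℝ), 0] + β • !₂[1 / 4, √3 / 4] + γ • !₂[0, 0])
        = β / 2 + γ / 3 := by
      simp [baryV]; linear_combination β / 12 * h - hs / 3
    have h3 : baryW (α • !₂[(1 : ℝ), 0] + β • !₂[1 / 4, √3 / 4] + γ • !₂[0, 0]) = γ / 3 := by
      simp [baryW]; linear_combination -β / 4 * h - hs
    rw [h1, h2, h3]
    exact ⟨by linarith, by linarith, by linarith⟩
  · rintro ⟨h1, h2, h3⟩
    refine ⟨baryU p - baryV p, 2 * (baryV p - baryW p), 3 * baryW p, by linarith, by linarith,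
      by linarith, ?_, ?_⟩
    · linear_combination bary_sum p
    ext i
    fin_cases i
    · simp [baryU, baryV, baryW]; ring
    · simp [baryV, baryW]; linear_combination (p 1 / 3) * h

theorem lowerHalf_subset_triangle : lowerHalf ⊆ triangle := fun p hp => by
  obtain ⟨h1, h2, h3⟩ := mem_lowerHalf.1 hp
  exact mem_triangle.2 ⟨h1, h2, h2.trans h3⟩

theorem sixth_subset_triangle : sixth ⊆ triangle := fun p hp => by
  obtain ⟨h1, h2, h3⟩ := mem_sixth.1 hp
  exact mem_triangle.2 ⟨by linarith, by linarith, h3⟩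

theorem isCompact_lowerHalf : IsCompact lowerHalf :=
  Set.Finite.isCompact_convexHull ℝ (by simp)

/-- If a neighbourhood of `p` lies where a function is nonnegative and the function decreases along
a line through `p`, then it is positive at `p`. -/
theorem pos_of_mem_interior {S : Set Plane} {f : Plane → ℝ} (hf : ∀ q ∈ S, 0 ≤ f q) {p d : Plane}
    (hd : ∀ t : ℝ, 0 < t → f (p + t • d) < f p) (hp : p ∈ interior S) : 0 < f p := by
  have h1 : Tendsto (fun t : ℝ => p + t • d) (𝓝 0) (𝓝 p) := by
    have : Continuous fun t : ℝ => p + t • d := by fun_prop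
    simpa using this.tendsto 0
  have h2 : ∀ᶠ t in 𝓝[>] (0 : ℝ), p + t • d ∈ S :=
    nhdsWithin_le_nhds (h1.eventually (mem_interior_iff_mem_nhds.1 hp))
  obtain ⟨t, ht, ht0⟩ := (h2.and self_mem_nhdsWithin).exists
  exact (hf _ ht).trans_lt (hd t ht0)

theorem mem_interior_triangle {p : Plane} :
    p ∈ interior triangle ↔ 0 < baryU p ∧ 0 < baryV p ∧ 0 < baryW p := by
  have h3 : 0 < √3 := by positivity
  constructor
  · refine fun hp => ⟨pos_of_mem_interior (fun q hq => (mem_triangle.1 hq).1)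
      (d := !₂[-1, 0]) (fun t ht => ?_) hp, pos_of_mem_interior
      (fun q hq => (mem_triangle.1 hq).2.1) (d := !₂[0, -1]) (fun t ht => ?_) hp,
      pos_of_mem_interior (fun q hq => (mem_triangle.1 hq).2.2) (d := !₂[0, 1])
      (fun t ht => ?_) hp⟩
    · simp [baryU]; linarith
    · simp [baryV]; nlinarith [mul_pos h3 ht]
    · simp [baryW]; nlinarith [mul_pos h3 ht]
  · intro hp
    refine interior_maximal (t := {q | 0 < baryU q ∧ 0 < baryV q ∧ 0 < baryW q})
      (fun q hq => mem_triangle.2 ⟨hq.1.le, hq.2.1.le, hq.2.2.le⟩) ?_ hp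
    exact (isOpen_lt continuous_const continuous_baryU).inter
      ((isOpen_lt continuous_const continuous_baryV).inter
        (isOpen_lt continuous_const continuous_baryW))

theorem isClosed_triangle : IsClosed triangle :=
  (Set.Finite.isCompact_convexHull ℝ (by simp)).isClosed

theorem mem_frontier_triangle {p : Plane} :
    p ∈ frontier triangle ↔ p ∈ triangle ∧ (baryU p = 0 ∨ baryV p = 0 ∨ baryW p = 0) := by
  rw [isClosed_triangle.frontier_eq, Set.mem_sdiff, mem_interior_triangle]
  refine and_congr_right fun hp => ?_
  obtain ⟨h1, h2, h3⟩ := mem_triangle.1 hp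
  constructor
  · intro h
    by_contra! hn
    exact h ⟨lt_of_le_of_ne h1 hn.1.symm, lt_of_le_of_ne h2 hn.2.1.symm,
      lt_of_le_of_ne h3 hn.2.2.symm⟩
  · rintro (h | h | h) ⟨k1, k2, k3⟩ <;> linarith

end Barycentric

/-! ### The reflections -/

section Mirrors

/-- The reflection in the `x`-axis. -/
def mirrorX (p : Plane) : Plane := !₂[p 0, -p 1]

/-- The reflection in the side opposite to `(1, 0)`. -/
def mirrorU (p : Plane) : Plane := !₂[-1 - p 0, p 1]

/-- The reflection in the side opposite to `(-1/2, √3/2)`. -/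
def mirrorV (p : Plane) : Plane := !₂[(p 0 + 1 + √3 * p 1) / 2, (√3 * p 0 - √3 - p 1) / 2]

/-- The reflection in the side opposite to `(-1/2, -√3/2)`. -/
def mirrorW (p : Plane) : Plane := !₂[(p 0 + 1 - √3 * p 1) / 2, (√3 - √3 * p 0 - p 1) / 2]

/-- The reflection in the line through the origin that exchanges the vertices `(1, 0)` and
`(-1/2, √3/2)`. -/
def mirrorUV (p : Plane) : Plane := !₂[(√3 * p 1 - p 0) / 2, (√3 * p 0 + p 1) / 2]

/-- An explicit formula for the reflection in the line through `a` and `b`, where `(m, n)` is a unit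
normal of the line and `l` the signed distance of `a` and `b`. -/
theorem reflection_affineSpan_pair {a b : Plane} {m n l : ℝ} (hn : m * m + n * n = 1) (hl : l ≠ 0)
    (h0 : b 0 = a 0 - l * n) (h1 : b 1 = a 1 + l * m) (p : Plane) :
    EuclideanGeometry.reflection (affineSpan ℝ {a, b}) p
      = !₂[p 0 - 2 * ((p 0 - a 0) * m + (p 1 - a 1) * n) * m,
        p 1 - 2 * ((p 0 - a 0) * m + (p 1 - a 1) * n) * n] := by
  set d := (p 0 - a 0) * m + (p 1 - a 1) * n with hd
  set v : Plane := d • !₂[m, n] with hv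
  have hmem : p - v ∈ affineSpan ℝ {a, b} := by
    have : p - v = AffineMap.lineMap a b (((p 1 - a 1) * m - (p 0 - a 0) * n) / l) := by
      ext i
      fin_cases i
      · simp [AffineMap.lineMap_apply, h0, hv, hd]
        field_simp
        linear_combination -(p 0 - a 0) * hn
      · simp [AffineMap.lineMap_apply, h1, hv, hd]
        field_simp
        linear_combination -(p 1 - a 1) * hn
    rw [this]
    exact AffineMap.lineMap_mem_affineSpan_pair _ _ _
  have hort : v ∈ (affineSpan ℝ {a, b}).directionᗮ := by
    rw [direction_affineSpan, Submodule.mem_orthogonal]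
    intro u hu
    obtain ⟨r, rfl⟩ := mem_vectorSpan_pair.1 hu
    simp only [PiLp.inner_apply, Fin.sum_univ_two]
    simp [hv, h0, h1]
    ring
  have h := EuclideanGeometry.reflection_orthogonal_vadd hmem hort
  rw [vadd_eq_add, add_sub_cancel, vadd_eq_add] at h
  rw [h]
  ext i
  fin_cases i
  · simp [hv]; ring
  · simp [hv]; ring

theorem reflection_eq_mirrorX (p : Plane) :
    EuclideanGeometry.reflection (affineSpan ℝ {!₂[(1 : ℝ), 0], !₂[-1 / 2, 0]}) p = mirrorX p := by
  rw [reflection_affineSpan_pair (m := 0) (n := 1) (l := 3 / 2) (by norm_num) (by norm_num)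
    (by simp; norm_num) (by simp)]
  ext i
  fin_cases i
  · simp [mirrorX]
  · simp [mirrorX]; ring

theorem reflection_eq_mirrorX' (p : Plane) :
    EuclideanGeometry.reflection (affineSpan ℝ {!₂[(1 : ℝ), 0], !₂[0, 0]}) p = mirrorX p := by
  rw [reflection_affineSpan_pair (m := 0) (n := 1) (l := 1) (by norm_num) (by norm_num)
    (by simp) (by simp)]
  ext i
  fin_cases i
  · simp [mirrorX]
  · simp [mirrorX]; ring

theorem reflection_eq_mirrorU (p : Plane) :
    EuclideanGeometry.reflection (affineSpan ℝ {!₂[(-1 / 2 : ℝ), 0], !₂[-1 / 2, -√3 / 2]}) p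
      = mirrorU p := by
  rw [reflection_affineSpan_pair (m := 1) (n := 0) (l := -√3 / 2) (by norm_num) (by simp)
    (by simp) (by simp)]
  ext i
  fin_cases i
  · simp [mirrorU]; ring
  · simp [mirrorU]

theorem reflection_eq_mirrorV (p : Plane) :
    EuclideanGeometry.reflection (affineSpan ℝ {!₂[(1 : ℝ), 0], !₂[-1 / 2, -√3 / 2]}) p
      = mirrorV p := by
  have h := sqrt_three_mul_self
  rw [reflection_affineSpan_pair (m := 1 / 2) (n := -√3 / 2) (l := -√3)
    (by linear_combination h / 4) (by simp) (by simp; linear_combination h / 2)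
    (by simp; ring)]
  ext i
  fin_cases i
  · simp [mirrorV]; ring
  · simp [mirrorV]; linear_combination -p 1 / 2 * h

theorem reflection_eq_mirrorW (p : Plane) :
    EuclideanGeometry.reflection (affineSpan ℝ {!₂[(1 : ℝ), 0], !₂[1 / 4, √3 / 4]}) p
      = mirrorW p := by
  have h := sqrt_three_mul_self
  rw [reflection_affineSpan_pair (m := 1 / 2) (n := √3 / 2) (l := √3 / 2)
    (by linear_combination h / 4) (by simp) (by simp; linear_combination h / 4)
    (by simp; ring)]
  ext i
  fin_cases i
  · simp [mirrorW]; ring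
  · simp [mirrorW]; linear_combination -p 1 / 2 * h

theorem reflection_eq_mirrorUV (p : Plane) :
    EuclideanGeometry.reflection (affineSpan ℝ {!₂[(1 / 4 : ℝ), √3 / 4], !₂[0, 0]}) p
      = mirrorUV p := by
  have h := sqrt_three_mul_self
  rw [reflection_affineSpan_pair (m := √3 / 2) (n := -1 / 2) (l := -1 / 2)
    (by linear_combination h / 4) (by norm_num) (by simp; norm_num)
    (by simp; ring)]
  ext i
  fin_cases i
  · simp [mirrorUV]; linear_combination -p 0 / 2 * h
  · simp [mirrorUV]; ring

theorem bary_mirrorX (p : Plane) : baryU (mirrorX p) = baryU p ∧ baryV (mirrorX p) = baryW p ∧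
    baryW (mirrorX p) = baryV p := by
  simp [baryU, baryV, baryW, mirrorX, sub_eq_add_neg]

theorem bary_mirrorUV (p : Plane) : baryU (mirrorUV p) = baryV p ∧ baryV (mirrorUV p) = baryU p ∧
    baryW (mirrorUV p) = baryW p := by
  have h := sqrt_three_mul_self
  refine ⟨?_, ?_, ?_⟩ <;> simp only [baryU, baryV, baryW, mirrorUV] <;> simp
  · ring
  · linear_combination p 0 / 2 * h
  · linear_combination -p 0 / 2 * h

theorem bary_mirrorU (p : Plane) : baryV (mirrorU p) = 1 - baryW p ∧
    baryW (mirrorU p) = 1 - baryV p := by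
  refine ⟨?_, ?_⟩ <;> simp only [baryV, baryW, mirrorU] <;> simp <;> ring

theorem bary_mirrorV (p : Plane) : baryV (mirrorV p) = -baryV p ∧
    baryW (mirrorV p) = baryV p + baryW p := by
  have h := sqrt_three_mul_self
  refine ⟨?_, ?_⟩ <;> simp only [baryV, baryW, mirrorV] <;> simp
  · linear_combination (p 0 - 1) / 6 * h
  · linear_combination (1 - p 0) / 6 * h

theorem bary_injective {p q : Plane} (h1 : baryV p = baryV q) (h2 : baryW p = baryW q) : p = q := by
  rw [← ofBary_bary p, ← ofBary_bary q, h1, h2]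

theorem mirrorX_mirrorX (p : Plane) : mirrorX (mirrorX p) = p := by
  ext i; fin_cases i <;> simp [mirrorX]

theorem mirrorUV_mirrorUV (p : Plane) : mirrorUV (mirrorUV p) = p := by
  obtain ⟨-, h1, h2⟩ := bary_mirrorUV (mirrorUV p)
  obtain ⟨k1, -, k2⟩ := bary_mirrorUV p
  exact bary_injective (h1.trans k1) (h2.trans k2)

theorem mirrorX_eq_self {p : Plane} (h : baryV p = baryW p) : mirrorX p = p := by
  obtain ⟨-, h1, h2⟩ := bary_mirrorX p
  exact bary_injective (by linarith) (by linarith)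

theorem mirrorUV_eq_self {p : Plane} (h : baryU p = baryV p) : mirrorUV p = p := by
  obtain ⟨-, h1, h2⟩ := bary_mirrorUV p
  exact bary_injective (by linarith) (by linarith)

theorem mirrorU_eq_self {p : Plane} (h : baryU p = 0) : mirrorU p = p := by
  obtain ⟨h1, h2⟩ := bary_mirrorU p
  have := bary_sum p
  exact bary_injective (by linarith) (by linarith)

theorem mirrorV_eq_self {p : Plane} (h : baryV p = 0) : mirrorV p = p := by
  obtain ⟨h1, h2⟩ := bary_mirrorV p
  exact bary_injective (by linarith) (by linarith)

theorem mirrorW_eq_self {p : Plane} (h : baryW p = 0) : mirrorW p = p := by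
  have h3 := sqrt_three_mul_self
  simp only [baryW] at h
  ext i
  fin_cases i
  · simp [mirrorW]; linear_combination (3 / 2) * h
  · simp [mirrorW]; linear_combination (√3 * 3 / 2) * h + p 1 / 2 * h3

theorem mirrorX_mem_triangle {p : Plane} (hp : p ∈ triangle) : mirrorX p ∈ triangle := by
  obtain ⟨h1, h2, h3⟩ := bary_mirrorX p
  rw [mem_triangle, h1, h2, h3]
  obtain ⟨k1, k2, k3⟩ := mem_triangle.1 hp
  exact ⟨k1, k3, k2⟩

theorem mirrorUV_mem_triangle {p : Plane} (hp : p ∈ triangle) : mirrorUV p ∈ triangle := by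
  obtain ⟨h1, h2, h3⟩ := bary_mirrorUV p
  rw [mem_triangle, h1, h2, h3]
  obtain ⟨k1, k2, k3⟩ := mem_triangle.1 hp
  exact ⟨k2, k1, k3⟩

/-- The triangle consists of its lower half and the mirror image of that. -/
theorem triangle_induction_lowerHalf {Q : Plane → Prop} (h : ∀ p ∈ lowerHalf, Q p)
    (hX : ∀ p, Q p → Q (mirrorX p)) {p : Plane} (hp : p ∈ triangle) : Q p := by
  obtain ⟨k1, k2, k3⟩ := mem_triangle.1 hp
  obtain ⟨h1, h2, h3⟩ := bary_mirrorX p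
  rcases le_total (baryV p) (baryW p) with hle | hle
  · exact h p (mem_lowerHalf.2 ⟨k1, k2, hle⟩)
  · rw [← mirrorX_mirrorX p]
    refine hX _ (h _ (mem_lowerHalf.2 ?_))
    rw [h1, h2, h3]
    exact ⟨k1, k3, hle⟩

/-- The triangle consists of the six images of `sixth` under the group generated by two of its
mirror symmetries: these exchange neighbouring barycentric coordinates, and `sixth` is where the
coordinates are sorted. -/
theorem triangle_induction_sixth {Q : Plane → Prop} (h : ∀ p ∈ sixth, Q p)
    (hX : ∀ p, Q p → Q (mirrorX p)) (hUV : ∀ p, Q p → Q (mirrorUV p)) {p : Plane}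
    (hp : p ∈ triangle) : Q p := by
  have hX' : ∀ p, Q (mirrorX p) → Q p := fun p hp => mirrorX_mirrorX p ▸ hX _ hp
  have hUV' : ∀ p, Q (mirrorUV p) → Q p := fun p hp => mirrorUV_mirrorUV p ▸ hUV _ hp
  have step1 : ∀ p ∈ triangle, baryW p ≤ baryV p → baryW p ≤ baryU p → Q p := by
    intro p hp h1 h2
    obtain ⟨k1, k2, k3⟩ := mem_triangle.1 hp
    rcases le_total (baryV p) (baryU p) with hle | hle
    · exact h p (mem_sixth.2 ⟨hle, h1, k3⟩)
    · refine hUV' p (h _ (mem_sixth.2 ?_))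
      obtain ⟨e1, e2, e3⟩ := bary_mirrorUV p
      rw [e1, e2, e3]
      exact ⟨hle, h2, k3⟩
  have step2 : ∀ p ∈ triangle, (baryW p ≤ baryU p ∨ baryV p ≤ baryU p) → Q p := by
    intro p hp h1
    obtain ⟨e1, e2, e3⟩ := bary_mirrorX p
    rcases le_total (baryW p) (baryV p) with hle | hle
    · exact step1 p hp hle (h1.elim id hle.trans)
    · refine hX' p (step1 _ (mirrorX_mem_triangle hp) ?_ ?_)
      · rwa [e2, e3]
      · rw [e1, e3]
        exact h1.elim hle.trans id
  by_cases h1 : baryV p ≤ baryU p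
  · exact step2 p hp (Or.inr h1)
  · refine hUV' p (step2 _ (mirrorUV_mem_triangle hp) (Or.inr ?_))
    obtain ⟨e1, e2, -⟩ := bary_mirrorUV p
    rw [e1, e2]
    exact (not_le.1 h1).le

end Mirrors

/-! ### The similarity and the Laplacian -/

section Transformation

theorem bary_trans (p : Plane) : baryU (trans p) - baryV (trans p) = baryU p ∧
    baryV (trans p) - baryW (trans p) = baryV p ∧ 3 * baryW (trans p) = baryW p - baryV p := by
  have h := sqrt_three_mul_self
  refine ⟨?_, ?_, ?_⟩ <;> simp only [baryU, baryV, baryW, trans] <;> simp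
  · linear_combination (p 0 - 1) / 18 * h
  · linear_combination (1 - p 0) / 9 * h
  · linear_combination (p 0 - 1) / 6 * h

theorem trans_mem_sixth {p : Plane} : trans p ∈ sixth ↔ p ∈ lowerHalf := by
  obtain ⟨h1, h2, h3⟩ := bary_trans p
  rw [mem_sixth, mem_lowerHalf]
  constructor <;> rintro ⟨k1, k2, k3⟩ <;> refine ⟨?_, ?_, ?_⟩ <;> linarith

theorem trans_mirrorX (p : Plane) : trans (mirrorX p) = mirrorW (trans p) := by
  have h := sqrt_three_mul_self
  ext i
  fin_cases i
  · simp [trans, mirrorX, mirrorW]; linear_combination (1 - p 0) / 12 * h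
  · simp [trans, mirrorX, mirrorW]; linear_combination p 1 / 12 * h

theorem trans_mirrorU (p : Plane) : trans (mirrorU p) = mirrorUV (trans p) := by
  have h := sqrt_three_mul_self
  ext i
  fin_cases i
  · simp [trans, mirrorU, mirrorUV]; linear_combination (p 0 - 1) / 12 * h
  · simp [trans, mirrorU, mirrorUV]; linear_combination -p 1 / 12 * h

theorem trans_mirrorV (p : Plane) : trans (mirrorV p) = mirrorX (trans p) := by
  have h := sqrt_three_mul_self
  ext i
  fin_cases i
  · simp [trans, mirrorX, mirrorV]; linear_combination (p 0 - 1) / 2 * h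
  · simp [trans, mirrorX, mirrorV]; linear_combination -p 1 / 12 * h

/-- The linear part of an orientation preserving similarity. -/
def rotScale (α β : ℝ) : Plane →L[ℝ] Plane :=
  LinearMap.toContinuousLinearMap
    { toFun := fun p => !₂[α * p 0 - β * p 1, β * p 0 + α * p 1]
      map_add' := fun p q => by
        ext i
        fin_cases i <;> simp <;> ring
      map_smul' := fun r p => by
        ext i
        fin_cases i <;> simp <;> ring }

theorem rotScale_apply (α β : ℝ) (p : Plane) :
    rotScale α β p = !₂[α * p 0 - β * p 1, β * p 0 + α * p 1] := rfl

theorem trans_eq (p : Plane) : trans p = rotScale (1 / 2) (-√3 / 6) p + !₂[1 / 2, √3 / 6] := by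
  ext i
  fin_cases i <;> simp [trans, rotScale_apply] <;> ring

theorem trans_symm_eq (p : Plane) :
    trans.symm p = rotScale (3 / 2) (√3 / 2) p + !₂[-1 / 2, -√3 / 2] := by
  ext i
  fin_cases i <;> simp [trans, rotScale_apply] <;> ring

theorem iteratedFDeriv_two_comp_affine {V : Type*} [NormedAddCommGroup V] [NormedSpace ℝ V]
    {f : V → ℝ} {L : V →L[ℝ] V} {b p : V} (hf : ContDiffAt ℝ 2 f (L p + b)) (e : V) :
    iteratedFDeriv ℝ 2 (fun q => f (L q + b)) p ![e, e]
      = fderiv ℝ (fderiv ℝ f) (L p + b) (L e) (L e) := by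
  rw [iteratedFDeriv_two_apply]
  simp only [Matrix.cons_val_zero, Matrix.cons_val_one]
  have hA : ∀ q, HasFDerivAt (fun q => L q + b) L q := fun q => L.hasFDerivAt.add_const b
  have hdiff : ∀ᶠ q in 𝓝 p, DifferentiableAt ℝ f (L q + b) := by
    have h1 : ∀ᶠ y in 𝓝 (L p + b), DifferentiableAt ℝ f y := by
      filter_upwards [hf.eventually (by simp)] with y hy
      exact hy.differentiableAt (by norm_num)
    exact (hA p).continuousAt.eventually h1
  have h1 : fderiv ℝ (fun q => f (L q + b)) =ᶠ[𝓝 p] fun q => (fderiv ℝ f (L q + b)).comp L := by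
    filter_upwards [hdiff] with q hq
    exact (HasFDerivAt.comp (f := fun q => L q + b) q hq.hasFDerivAt (hA q)).fderiv
  have h2 : HasFDerivAt (fderiv ℝ f) (fderiv ℝ (fderiv ℝ f) (L p + b)) (L p + b) :=
    ((hf.fderiv_right (m := 1) (by norm_num)).differentiableAt (by norm_num)).hasFDerivAt
  have h3 : HasFDerivAt (fun q => fderiv ℝ f (L q + b))
      ((fderiv ℝ (fderiv ℝ f) (L p + b)).comp L) p :=
    HasFDerivAt.comp (f := fun q => L q + b) p h2 (hA p)
  have h4 := h3.clm_comp (hasFDerivAt_const L p)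
  rw [h1.fderiv_eq, h4.fderiv]
  simp

theorem laplacian_comp_rotScale {f : Plane → ℝ} {α β : ℝ} {b p : Plane}
    (hf : ContDiffAt ℝ 2 f (rotScale α β p + b)) :
    Δ (fun q => f (rotScale α β q + b)) p
      = (α ^ 2 + β ^ 2) * Δ f (rotScale α β p + b) := by
  rw [InnerProductSpace.laplacian_eq_iteratedFDeriv_orthonormalBasis _
    (EuclideanSpace.basisFun (Fin 2) ℝ),
    InnerProductSpace.laplacian_eq_iteratedFDeriv_orthonormalBasis _
    (EuclideanSpace.basisFun (Fin 2) ℝ)]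
  simp only [iteratedFDeriv_two_comp_affine hf, Fin.sum_univ_two, EuclideanSpace.basisFun_apply]
  simp only [iteratedFDeriv_two_apply, Matrix.cons_val_zero, Matrix.cons_val_one]
  generalize fderiv ℝ (fderiv ℝ f) (rotScale α β p + b) = B
  set e₀ : Plane := EuclideanSpace.single 0 1
  set e₁ : Plane := EuclideanSpace.single 1 1
  have h0 : rotScale α β e₀ = α • e₀ + β • e₁ := by
    ext i
    fin_cases i <;> simp [rotScale_apply, e₀, e₁]
  have h1 : rotScale α β e₁ = -β • e₀ + α • e₁ := by
    ext i
    fin_cases i <;> simp [rotScale_apply, e₀, e₁]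
  rw [h0, h1]
  simp only [map_add, map_smul, add_apply, smul_apply,
    smul_eq_mul]
  ring

theorem laplacian_comp_trans {f : Plane → ℝ} {p : Plane} (hf : ContDiffAt ℝ 2 f (trans p)) :
    Δ (f ∘ trans) p = 1 / 3 * Δ f (trans p) := by
  have h : f ∘ trans = fun q => f (rotScale (1 / 2) (-√3 / 6) q + !₂[1 / 2, √3 / 6]) :=
    funext fun q => congrArg f (trans_eq q)
  rw [trans_eq] at hf ⊢
  rw [h, laplacian_comp_rotScale hf]
  congr 1
  linear_combination sqrt_three_mul_self / 36

theorem laplacian_comp_trans_symm {f : Plane → ℝ} {p : Plane}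
    (hf : ContDiffAt ℝ 2 f (trans.symm p)) :
    Δ (f ∘ trans.symm) p = 3 * Δ f (trans.symm p) := by
  have h : f ∘ trans.symm = fun q => f (rotScale (3 / 2) (√3 / 2) q + !₂[-1 / 2, -√3 / 2]) :=
    funext fun q => congrArg f (trans_symm_eq q)
  rw [trans_symm_eq] at hf ⊢
  rw [h, laplacian_comp_rotScale hf]
  congr 1
  linear_combination sqrt_three_mul_self / 4

theorem contDiff_trans : ContDiff ℝ 2 trans := by
  rw [show (trans : Plane → Plane) = fun q => _ from funext trans_eq]
  fun_prop

theorem contDiff_trans_symm : ContDiff ℝ 2 trans.symm := by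
  rw [show (trans.symm : Plane → Plane) = fun q => _ from funext trans_symm_eq]
  fun_prop

end Transformation

/-! ### Tessellations -/

section Extension

theorem isBackwardImage_iff {g F : Plane → ℝ} : IsBackwardImage g F ↔
    Set.EqOn F (g ∘ trans) lowerHalf ∧ (∀ p, F (mirrorX p) = -F p) ∧
      (∀ p, F (mirrorU p) = -F p) ∧ ∀ p, F (mirrorV p) = -F p := by
  constructor
  · rintro ⟨h, h1, h2, h3⟩
    simp only [reflection_eq_mirrorX, reflection_eq_mirrorU, reflection_eq_mirrorV] at h1 h2 h3
    exact ⟨h, h1, h2, h3⟩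
  · rintro ⟨h, h1, h2, h3⟩
    refine ⟨h, ?_, ?_, ?_⟩
    · simpa only [reflection_eq_mirrorX] using h1
    · simpa only [reflection_eq_mirrorU] using h2
    · simpa only [reflection_eq_mirrorV] using h3

theorem isForwardImage_iff {f G : Plane → ℝ} : IsForwardImage f G ↔
    Set.EqOn G (f ∘ trans.symm) sixth ∧ (∀ p, G (mirrorW p) = -G p) ∧
      (∀ p, G (mirrorUV p) = -G p) ∧ ∀ p, G (mirrorX p) = -G p := by
  constructor
  · rintro ⟨h, h1, h2, h3⟩
    simp only [reflection_eq_mirrorW, reflection_eq_mirrorUV, reflection_eq_mirrorX'] at h1 h2 h3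
    exact ⟨h, h1, h2, h3⟩
  · rintro ⟨h, h1, h2, h3⟩
    refine ⟨h, ?_, ?_, ?_⟩
    · simpa only [reflection_eq_mirrorW] using h1
    · simpa only [reflection_eq_mirrorUV] using h2
    · simpa only [reflection_eq_mirrorX'] using h3

theorem exists_isometry_mirrorX : ∃ ρ : Plane ≃ᵃⁱ[ℝ] Plane, ∀ p, ρ p = mirrorX p :=
  ⟨_, reflection_eq_mirrorX⟩

theorem exists_isometry_mirrorU : ∃ ρ : Plane ≃ᵃⁱ[ℝ] Plane, ∀ p, ρ p = mirrorU p :=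
  ⟨_, reflection_eq_mirrorU⟩

theorem exists_isometry_mirrorV : ∃ ρ : Plane ≃ᵃⁱ[ℝ] Plane, ∀ p, ρ p = mirrorV p :=
  ⟨_, reflection_eq_mirrorV⟩

theorem continuous_mirrorX : Continuous mirrorX := by
  obtain ⟨ρ, hρ⟩ := exists_isometry_mirrorX
  rw [← show (ρ : Plane → Plane) = mirrorX from funext hρ]
  exact ρ.continuous

theorem exists_odd_extension {φ : Plane → ℝ} {M : ℝ} (hc : Continuous φ) (hM : ∀ p, |φ p| ≤ M)
    (hs : ∀ p, φ p ≠ 0 → 0 < baryU p ∧ 0 < baryV p ∧ 0 < baryW p)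
    (hX : ∀ p, φ (mirrorX p) = -φ p) :
    ∃ F : Plane → ℝ, Continuous F ∧ (∀ p, |F p| ≤ 6 * M) ∧ Set.EqOn F φ triangle ∧
      (∀ p, F (mirrorX p) = -F p) ∧ (∀ p, F (mirrorU p) = -F p) ∧
      ∀ p, F (mirrorV p) = -F p := by
  have hsupp : IsTriangleSupported (φ ∘ ofBary) := fun x hx => by
    obtain ⟨h1, h2, h3⟩ := hs _ hx
    have := bary_sum (ofBary x)
    rw [baryV_ofBary] at h2 this
    rw [baryW_ofBary] at h3 this
    exact ⟨h2, h3, by linarith⟩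
  have hswap : ∀ a b, (φ ∘ ofBary) (b, a) = -(φ ∘ ofBary) (a, b) := fun a b => by
    simp only [Function.comp]
    rw [← hX]
    congr 1
    obtain ⟨-, h1, h2⟩ := bary_mirrorX (ofBary (a, b))
    exact bary_injective (by rw [h1, baryV_ofBary, baryW_ofBary])
      (by rw [h2, baryV_ofBary, baryW_ofBary])
  refine ⟨fun p => latticeSum (φ ∘ ofBary) (baryV p, baryW p),
    (continuous_latticeSum hsupp (hc.comp continuous_ofBary)).comp (by fun_prop),
    fun p => abs_latticeSum_le hsupp (fun x => hM _) _, fun p hp => ?_, fun p => ?_, fun p => ?_,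
    fun p => ?_⟩
  · obtain ⟨h1, h2, h3⟩ := mem_triangle.1 hp
    have := bary_sum p
    simp only
    rw [latticeSum_eq_self hsupp h2 h3 (by linarith)]
    simp [ofBary_bary]
  · obtain ⟨-, h1, h2⟩ := bary_mirrorX p
    simp only [h1, h2]
    exact latticeSum_swap hswap (baryV p, baryW p)
  · obtain ⟨h1, h2⟩ := bary_mirrorU p
    simp only [h1, h2]
    exact latticeSum_reflect₂ hswap _ _
  · obtain ⟨h1, h2⟩ := bary_mirrorV p
    simp only [h1, h2]
    exact latticeSum_reflect₁ hswap _ _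

/-- The open lower half of the triangle. -/
def openLowerHalf : Set Plane := {p | 0 < baryU p ∧ 0 < baryV p ∧ baryV p < baryW p}

theorem isOpen_openLowerHalf : IsOpen openLowerHalf :=
  (isOpen_lt continuous_const continuous_baryU).inter
    ((isOpen_lt continuous_const continuous_baryV).inter
      (isOpen_lt continuous_baryV continuous_baryW))

theorem openLowerHalf_subset : openLowerHalf ⊆ lowerHalf := fun _ hp =>
  mem_lowerHalf.2 ⟨hp.1.le, hp.2.1.le, hp.2.2.le⟩

theorem openLowerHalf_subset_interior : openLowerHalf ⊆ interior triangle := fun _ hp =>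
  mem_interior_triangle.2 ⟨hp.1, hp.2.1, hp.2.1.trans hp.2.2⟩

theorem boundary_of_notMem_openLowerHalf {p : Plane} (hp : p ∈ lowerHalf)
    (hn : p ∉ openLowerHalf) : baryU p = 0 ∨ baryV p = 0 ∨ baryV p = baryW p := by
  obtain ⟨h1, h2, h3⟩ := mem_lowerHalf.1 hp
  by_contra! h
  exact hn ⟨lt_of_le_of_ne h1 h.1.symm, lt_of_le_of_ne h2 h.2.1.symm, lt_of_le_of_ne h3 h.2.2⟩

/-- A continuous function on the lower half that vanishes on its boundary has a reflection
tessellation, which is continuous and bounded. -/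
theorem exists_tessellation {h : Plane → ℝ} (hc : ContinuousOn h lowerHalf)
    (h0 : ∀ p ∈ lowerHalf, p ∉ openLowerHalf → h p = 0) :
    ∃ F : Plane → ℝ, Continuous F ∧ (∃ M, ∀ p, |F p| ≤ M) ∧ Set.EqOn F h lowerHalf ∧
      (∀ p, F (mirrorX p) = -F p) ∧ (∀ p, F (mirrorU p) = -F p) ∧
      ∀ p, F (mirrorV p) = -F p := by
  have hcl : IsClosed lowerHalf := isCompact_lowerHalf.isClosed
  set k : Plane → ℝ := lowerHalf.indicator h with hk
  have hkc : Continuous k := by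
    refine continuous_indicator (fun p hp => ?_) (by rwa [hcl.closure_eq])
    rw [hcl.frontier_eq] at hp
    exact h0 p hp.1 fun hn =>
      hp.2 (interior_maximal openLowerHalf_subset isOpen_openLowerHalf hn)
  have hks : ∀ p, k p ≠ 0 → p ∈ openLowerHalf := fun p hp => by
    by_contra hn
    by_cases hm : p ∈ lowerHalf
    · exact hp (by rw [hk, Set.indicator_of_mem hm, h0 p hm hn])
    · exact hp (Set.indicator_of_notMem hm h)
  obtain ⟨C, hC⟩ := isCompact_lowerHalf.exists_bound_of_continuousOn hc
  have hkb : ∀ p, |k p| ≤ |C| := fun p => by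
    by_cases hm : p ∈ lowerHalf
    · rw [hk, Set.indicator_of_mem hm]
      exact (hC p hm).trans (le_abs_self C)
    · rw [hk, Set.indicator_of_notMem hm, abs_zero]
      exact abs_nonneg C
  have hsupp : ∀ p, k p - k (mirrorX p) ≠ 0 → 0 < baryU p ∧ 0 < baryV p ∧ 0 < baryW p :=
      fun p hp => by
    by_cases h1 : k p = 0
    · obtain ⟨e1, e2, e3⟩ := hks (mirrorX p) fun h2 => hp (by simp [h1, h2])
      obtain ⟨k1, k2, k3⟩ := bary_mirrorX p
      exact ⟨by linarith, by linarith, by linarith⟩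
    · obtain ⟨e1, e2, e3⟩ := hks p h1
      exact ⟨e1, e2, e2.trans e3⟩
  obtain ⟨F, hF, hFb, hFe, hF1, hF2, hF3⟩ := exists_odd_extension
    (φ := fun p => k p - k (mirrorX p)) (M := |C| + |C|) (hkc.sub (hkc.comp continuous_mirrorX))
    (fun p => (abs_sub _ _).trans (add_le_add (hkb _) (hkb _))) hsupp
    (fun p => by simp [mirrorX_mirrorX])
  refine ⟨F, hF, ⟨_, hFb⟩, fun p hp => ?_, hF1, hF2, hF3⟩
  rw [hFe (lowerHalf_subset_triangle hp)]
  have h1 : k (mirrorX p) = 0 := by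
    by_contra hn
    obtain ⟨-, -, e⟩ := hks _ hn
    obtain ⟨-, e2, e3⟩ := bary_mirrorX p
    linarith [(mem_lowerHalf.1 hp).2.2]
  simp only [h1, sub_zero]
  exact Set.indicator_of_mem hp h

/-- The points at which the heat flow of `F` is the damping of `F` with rate `c`. -/
def dampedSet (c : ℝ) (F : Plane → ℝ) : Set Plane :=
  {p | ∀ t, 0 ≤ t → heatFlow F p t = heatMass * Real.exp (-c * t) * F p}

theorem isometry_mem_dampedSet {c : ℝ} {F : Plane → ℝ} {ρ : Plane ≃ᵃⁱ[ℝ] Plane}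
    (hρ : ∀ q, F (ρ q) = -F q) {p : Plane} (hp : p ∈ dampedSet c F) : ρ p ∈ dampedSet c F :=
  fun t ht => by rw [heatFlow_odd hρ, hρ, hp t ht]; ring

/-- A solution of the Helmholtz equation in the lower half with zero boundary values has a
reflection tessellation that the heat flow damps on the lower half. -/
theorem exists_tessellation_damped {h : Plane → ℝ} {c : ℝ} (hc : ContinuousOn h lowerHalf)
    (h0 : ∀ p ∈ lowerHalf, p ∉ openLowerHalf → h p = 0) (h2 : ContDiffOn ℝ 2 h openLowerHalf)
    (hh : ∀ p ∈ openLowerHalf, Δ h p + c * h p = 0) :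
    ∃ F : Plane → ℝ, Continuous F ∧ (∃ M, ∀ p, |F p| ≤ M) ∧ Set.EqOn F h lowerHalf ∧
      (∀ p, F (mirrorX p) = -F p) ∧ (∀ p, F (mirrorU p) = -F p) ∧
      (∀ p, F (mirrorV p) = -F p) ∧ lowerHalf ⊆ dampedSet c F := by
  obtain ⟨F, hF, ⟨M, hM⟩, hFe, hF1, hF2, hF3⟩ := exists_tessellation hc h0
  refine ⟨F, hF, ⟨M, hM⟩, hFe, hF1, hF2, hF3, fun p hp t ht => ?_⟩
  have hFe' : Set.EqOn F h openLowerHalf := hFe.mono openLowerHalf_subset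
  refine heatFlow_eq_of_odd hF hM isCompact_lowerHalf isOpen_openLowerHalf openLowerHalf_subset
    (h2.congr hFe') (fun q hq => ?_) (fun q hq hn => ?_) hp ht
  · have : F =ᶠ[𝓝 q] h := Filter.eventuallyEq_of_mem (isOpen_openLowerHalf.mem_nhds hq) hFe'
    rw [(InnerProductSpace.laplacian_congr_nhds this).eq_of_nhds, hFe' hq]
    exact hh q hq
  · obtain ⟨ρ1, hρ1⟩ := exists_isometry_mirrorX
    obtain ⟨ρ2, hρ2⟩ := exists_isometry_mirrorU
    obtain ⟨ρ3, hρ3⟩ := exists_isometry_mirrorV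
    rcases boundary_of_notMem_openLowerHalf hq hn with h | h | h
    · exact ⟨ρ2, by rw [hρ2, mirrorU_eq_self h], fun q => by rw [hρ2, hF2]⟩
    · exact ⟨ρ3, by rw [hρ3, mirrorV_eq_self h], fun q => by rw [hρ3, hF3]⟩
    · exact ⟨ρ1, by rw [hρ1, mirrorX_eq_self h], fun q => by rw [hρ1, hF1]⟩

end Extension

/-! ### The symmetry classes -/

section Classes

/-- The rotation by 120 degrees clockwise, as a composition of two reflections. -/
def rotInv (p : Plane) : Plane := mirrorX (mirrorUV p)

theorem act_reflectionMatrix (f : Plane → ℝ) (p : Plane) :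
    act reflectionMatrix f p = f (mirrorX p) := by
  have h : reflectionMatrix⁻¹ = reflectionMatrix := by
    refine Matrix.inv_eq_right_inv ?_
    ext i j
    fin_cases i <;> fin_cases j <;> simp [reflectionMatrix, Matrix.mul_apply, Fin.sum_univ_two]
  rw [act, h]
  congr 1
  ext i
  fin_cases i <;> simp [reflectionMatrix, mirrorX, Matrix.mulVec, dotProduct, Fin.sum_univ_two]

theorem act_rotationMatrix (f : Plane → ℝ) (p : Plane) :
    act rotationMatrix f p = f (rotInv p) := by
  have h3 := sqrt_three_mul_self
  have h : rotationMatrix⁻¹ = !![-1 / 2, √3 / 2; -√3 / 2, -1 / 2] := by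
    refine Matrix.inv_eq_right_inv ?_
    ext i j
    fin_cases i <;> fin_cases j <;>
      simp [rotationMatrix, Matrix.mul_apply, Fin.sum_univ_two]
    · linear_combination h3 / 4
    · ring
    · ring
    · linear_combination h3 / 4
  rw [act, h]
  congr 1
  ext i
  fin_cases i <;>
    simp [rotInv, mirrorUV, mirrorX, Matrix.mulVec, dotProduct, Fin.sum_univ_two] <;> ring

theorem rotInv_mem_triangle {p : Plane} (hp : p ∈ triangle) : rotInv p ∈ triangle :=
  mirrorX_mem_triangle (mirrorUV_mem_triangle hp)

theorem rotInv_rotInv_rotInv (p : Plane) : rotInv (rotInv (rotInv p)) = p := by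
  have h : ∀ q, baryU (rotInv q) = baryV q ∧ baryV (rotInv q) = baryW q ∧
      baryW (rotInv q) = baryU q := fun q => by
    obtain ⟨h1, h2, h3⟩ := bary_mirrorX (mirrorUV q)
    obtain ⟨k1, k2, k3⟩ := bary_mirrorUV q
    exact ⟨h1.trans k1, h2.trans k3, h3.trans k2⟩
  refine bary_injective ?_ ?_
  · rw [(h _).2.1, (h _).2.2, (h _).1]
  · rw [(h _).2.2, (h _).1, (h _).2.1]

theorem IsDirichletSolution.of_contDiff {f g : Plane → ℝ} {c : ℝ} (hg : ContDiff ℝ 2 g)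
    (hfg : Set.EqOn g f triangle) (hh : ∀ p ∈ triangle, Δ g p + c * g p = 0)
    (hb : ∀ p ∈ triangle, (baryU p = 0 ∨ baryV p = 0 ∨ baryW p = 0) → f p = 0)
    (hn : ∃ p ∈ triangle, f p ≠ 0) : IsDirichletSolution c f where
  continuousOn := hg.continuous.continuousOn.congr hfg.symm
  contDiffOn := hg.contDiffOn.congr (hfg.symm.mono interior_subset)
  helmholtz p hp := by
    have : f =ᶠ[𝓝 p] g := Filter.eventuallyEq_of_mem (mem_interior_iff_mem_nhds.1 hp) hfg.symm
    rw [(InnerProductSpace.laplacian_congr_nhds this).eq_of_nhds, this.eq_of_nhds]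
    exact hh p (interior_subset hp)
  boundary p hp := hb p (mem_frontier_triangle.1 hp).1 (mem_frontier_triangle.1 hp).2
  nontrivial := hn

/-- What the classes A2 and E2 have in common. -/
theorem isDirichletSolution_and_odd {f : Plane → ℝ} {c : ℝ} (hf : f ∈ classE2 c ∪ classA2 c) :
    IsDirichletSolution c f ∧ ∀ p ∈ triangle, f (mirrorX p) = -f p := by
  rcases hf with ⟨h, -, -, hX⟩ | ⟨h, -, hX⟩ <;>
  exact ⟨h, fun p hp => (act_reflectionMatrix _ p).symm.trans (hX hp)⟩

theorem IsDirichletSolution.eq_zero {f : Plane → ℝ} {c : ℝ} (hf : IsDirichletSolution c f)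
    {p : Plane} (hp : p ∈ triangle) (h : baryU p = 0 ∨ baryV p = 0 ∨ baryW p = 0) : f p = 0 :=
  hf.boundary p (mem_frontier_triangle.2 ⟨hp, h⟩)

/-- A function that is odd under two mirror symmetries of the triangle and one more reflection in a
side vanishes on the whole boundary. -/
theorem eq_zero_of_odd_forward {G : Plane → ℝ} (hW : ∀ p, G (mirrorW p) = -G p)
    (hUV : ∀ p, G (mirrorUV p) = -G p) (hX : ∀ p, G (mirrorX p) = -G p) {p : Plane}
    (h : baryU p = 0 ∨ baryV p = 0 ∨ baryW p = 0) : G p = 0 := by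
  have h1 : ∀ p, baryW p = 0 → G p = 0 := fun p hp => by
    have := hW p
    rw [mirrorW_eq_self hp] at this
    linarith
  have h2 : ∀ p, baryV p = 0 → G p = 0 := fun p hp => by
    have := h1 (mirrorX p) ((bary_mirrorX p).2.2.trans hp)
    rw [hX] at this
    linarith
  rcases h with h | h | h
  · have := h2 (mirrorUV p) ((bary_mirrorUV p).2.1.trans h)
    rw [hUV] at this
    linarith
  · exact h2 p h
  · exact h1 p h

theorem eq_zero_of_odd_backward {F : Plane → ℝ} (hX : ∀ p, F (mirrorX p) = -F p)
    (hU : ∀ p, F (mirrorU p) = -F p) (hV : ∀ p, F (mirrorV p) = -F p) {p : Plane}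
    (h : baryU p = 0 ∨ baryV p = 0 ∨ baryW p = 0) : F p = 0 := by
  have h1 : ∀ p, baryV p = 0 → F p = 0 := fun p hp => by
    have := hV p
    rw [mirrorV_eq_self hp] at this
    linarith
  rcases h with h | h | h
  · have := hU p
    rw [mirrorU_eq_self h] at this
    linarith
  · exact h1 p h
  · have := h1 (mirrorX p) ((bary_mirrorX p).2.1.trans h)
    rw [hX] at this
    linarith

end Classes

/-! ### The forward image -/

section Forward

variable {f : Plane → ℝ} {c : ℝ}

/-- The forward image exists, and on the triangle it coincides with a function that is `C²` on the
whole plane and solves the Helmholtz equation on the closed triangle. -/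
theorem exists_isForwardImage (hf : IsDirichletSolution c f)
    (hX : ∀ p ∈ triangle, f (mirrorX p) = -f p) :
    ∃ G g : Plane → ℝ, IsForwardImage f G ∧ ContDiff ℝ 2 g ∧ Set.EqOn g G triangle ∧
      ∀ p ∈ triangle, Δ g p + 3 * c * g p = 0 := by
  have h0 : ∀ p ∈ lowerHalf, p ∉ openLowerHalf → f p = 0 := fun p hp hn => by
    rcases boundary_of_notMem_openLowerHalf hp hn with h | h | h
    · exact hf.eq_zero (lowerHalf_subset_triangle hp) (Or.inl h)
    · exact hf.eq_zero (lowerHalf_subset_triangle hp) (Or.inr (Or.inl h))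
    · have := hX p (lowerHalf_subset_triangle hp)
      rw [mirrorX_eq_self h] at this
      linarith
  obtain ⟨F, hF, ⟨M, hM⟩, hFe, hF1, hF2, hF3, hd⟩ := exists_tessellation_damped (h := f) (c := c)
    (hf.continuousOn.mono lowerHalf_subset_triangle) h0
    (hf.contDiffOn.mono openLowerHalf_subset_interior)
    (fun p hp => hf.helmholtz p (openLowerHalf_subset_interior hp))
  obtain ⟨g, hg, hge, hgh⟩ := exists_contDiff_of_heatFlow_eq (S := dampedSet c F) (c := c) hF hM
    fun p hp => hp
  -- `T⁻¹` maps the triangle into the images of the lower half around one of its vertices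
  have hmem : ∀ p ∈ triangle, trans.symm p ∈ dampedSet c F := by
    intro p hp
    refine triangle_induction_sixth (Q := fun p => trans.symm p ∈ dampedSet c F)
      (fun q hq => hd ?_) (fun q hq => ?_) (fun q hq => ?_) hp
    · rw [← trans_mem_sixth, Equiv.apply_symm_apply]
      exact hq
    · obtain ⟨ρ, hρ⟩ := exists_isometry_mirrorV
      have h := isometry_mem_dampedSet (ρ := ρ) (fun q => by rw [hρ, hF3]) hq
      rwa [hρ, ← trans.symm_apply_apply (mirrorV _), trans_mirrorV, trans.apply_symm_apply] at h
    · obtain ⟨ρ, hρ⟩ := exists_isometry_mirrorU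
      have h := isometry_mem_dampedSet (ρ := ρ) (fun q => by rw [hρ, hF2]) hq
      rwa [hρ, ← trans.symm_apply_apply (mirrorU _), trans_mirrorU, trans.apply_symm_apply] at h
  refine ⟨F ∘ trans.symm, g ∘ trans.symm, isForwardImage_iff.2 ⟨fun p hp => ?_, fun p => ?_,
    fun p => ?_, fun p => ?_⟩, hg.comp contDiff_trans_symm, fun p hp => hge (hmem p hp),
    fun p hp => ?_⟩
  · refine hFe ?_
    rw [← trans_mem_sixth, Equiv.apply_symm_apply]
    exact hp
  · obtain ⟨q, rfl⟩ := trans.surjective p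
    simp only [Function.comp]
    rw [← trans_mirrorX, trans.symm_apply_apply, trans.symm_apply_apply, hF1]
  · obtain ⟨q, rfl⟩ := trans.surjective p
    simp only [Function.comp]
    rw [← trans_mirrorU, trans.symm_apply_apply, trans.symm_apply_apply, hF2]
  · obtain ⟨q, rfl⟩ := trans.surjective p
    simp only [Function.comp]
    rw [← trans_mirrorV, trans.symm_apply_apply, trans.symm_apply_apply, hF3]
  · rw [laplacian_comp_trans_symm hg.contDiffAt]
    have := hgh _ (hmem p hp)
    simp only [Function.comp]
    linear_combination 3 * this

theorem IsForwardImage.eqOn_triangle {f' G G' : Plane → ℝ} (hff' : Set.EqOn f f' lowerHalf)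
    (hG : IsForwardImage f G) (hG' : IsForwardImage f' G') : Set.EqOn G G' triangle := by
  obtain ⟨h, -, h2, h3⟩ := isForwardImage_iff.1 hG
  obtain ⟨k, -, k2, k3⟩ := isForwardImage_iff.1 hG'
  intro p hp
  refine triangle_induction_sixth (Q := fun p => G p = G' p) (fun q hq => ?_) (fun q hq => ?_)
    (fun q hq => ?_) hp
  · rw [h hq, k hq]
    refine hff' ?_
    rw [← trans_mem_sixth, Equiv.apply_symm_apply]
    exact hq
  · rw [h3, k3, hq]
  · rw [h2, k2, hq]

theorem IsForwardImage.mem_classA2 {G : Plane → ℝ} (hf : IsDirichletSolution c f)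
    (hX : ∀ p ∈ triangle, f (mirrorX p) = -f p) (hG : IsForwardImage f G) :
    G ∈ classA2 (3 * c) := by
  obtain ⟨G', g, hG', hg, hgG, hgh⟩ := exists_isForwardImage hf hX
  have hGG' := hG.eqOn_triangle (fun _ _ => rfl) hG'
  obtain ⟨h, h1, h2, h3⟩ := isForwardImage_iff.1 hG
  refine ⟨.of_contDiff hg (hgG.trans hGG'.symm) hgh
    (fun p _ hp => eq_zero_of_odd_forward h1 h2 h3 hp) ?_, fun p _ => ?_, fun p _ => ?_⟩
  · by_contra! hn
    obtain ⟨p, hp, hne⟩ := hf.nontrivial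
    refine hne (triangle_induction_lowerHalf (Q := fun p => p ∈ triangle ∧ f p = 0)
      (fun q hq => ⟨lowerHalf_subset_triangle hq, ?_⟩)
      (fun q hq => ⟨mirrorX_mem_triangle hq.1, by rw [hX q hq.1, hq.2, neg_zero]⟩) hp).2
    have hT := trans_mem_sixth.2 hq
    have := h hT
    rw [hn _ (sixth_subset_triangle hT)] at this
    simpa using this.symm
  · rw [act_rotationMatrix, rotInv, h3, h2, neg_neg]
  · rw [act_reflectionMatrix, h3]
    rfl

end Forward

/-! ### The backward image -/

section Backward

variable {g : Plane → ℝ} {c : ℝ}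

theorem odd_of_mem_classA2 (hg : g ∈ classA2 c) :
    (∀ p ∈ triangle, g (mirrorX p) = -g p) ∧ ∀ p ∈ triangle, g (mirrorUV p) = -g p := by
  obtain ⟨-, hr, hX⟩ := hg
  have h1 : ∀ p ∈ triangle, g (mirrorX p) = -g p := fun p hp => by
    exact (act_reflectionMatrix _ p).symm.trans (hX hp)
  refine ⟨h1, fun p hp => ?_⟩
  have h2 := hr hp
  rw [act_rotationMatrix, rotInv, h1 _ (mirrorUV_mem_triangle hp)] at h2
  linarith

/-- The backward image exists, and on the triangle it coincides with a function that is `C²` on the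
whole plane and solves the Helmholtz equation on the closed triangle. -/
theorem exists_isBackwardImage (hg : g ∈ classA2 c) :
    ∃ F f : Plane → ℝ, IsBackwardImage g F ∧ ContDiff ℝ 2 f ∧ Set.EqOn f F triangle ∧
      ∀ p ∈ triangle, Δ f p + c / 3 * f p = 0 := by
  obtain ⟨hX, hUV⟩ := odd_of_mem_classA2 hg
  have hs := hg.1
  have hmem : ∀ p ∈ lowerHalf, trans p ∈ triangle := fun p hp =>
    sixth_subset_triangle (trans_mem_sixth.2 hp)
  have hint : ∀ p ∈ openLowerHalf, trans p ∈ interior triangle := fun p hp => by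
    obtain ⟨h1, h2, h3⟩ := bary_trans p
    obtain ⟨k1, k2, k3⟩ := hp
    exact mem_interior_triangle.2 ⟨by linarith, by linarith, by linarith⟩
  have h0 : ∀ p ∈ lowerHalf, p ∉ openLowerHalf → (g ∘ trans) p = 0 := fun p hp hn => by
    obtain ⟨e1, e2, e3⟩ := bary_trans p
    have hm := hmem p hp
    simp only [Function.comp]
    rcases boundary_of_notMem_openLowerHalf hp hn with h | h | h
    · have := hUV _ hm
      rw [mirrorUV_eq_self (by linarith)] at this
      linarith
    · have := hX _ hm
      rw [mirrorX_eq_self (by linarith)] at this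
      linarith
    · exact hs.eq_zero hm (Or.inr (Or.inr (by linarith)))
  have hH : ∀ p ∈ openLowerHalf, Δ (g ∘ trans) p + c / 3 * (g ∘ trans) p = 0 := fun p hp => by
    have hi := hint p hp
    rw [laplacian_comp_trans (hs.contDiffOn.contDiffAt (isOpen_interior.mem_nhds hi))]
    have := hs.helmholtz _ hi
    simp only [Function.comp]
    linear_combination 1 / 3 * this
  obtain ⟨F, hF, ⟨M, hM⟩, hFe, hF1, hF2, hF3, hd⟩ := exists_tessellation_damped (h := g ∘ trans)
    (c := c / 3) (hs.continuousOn.comp contDiff_trans.continuous.continuousOn hmem)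
    h0 (hs.contDiffOn.comp contDiff_trans.contDiffOn hint) hH
  obtain ⟨f, hf, hfe, hfh⟩ := exists_contDiff_of_heatFlow_eq (S := dampedSet (c / 3) F)
    (c := c / 3) hF hM fun p hp => hp
  have hsub : triangle ⊆ dampedSet (c / 3) F := fun p hp => by
    obtain ⟨ρ, hρ⟩ := exists_isometry_mirrorX
    refine triangle_induction_lowerHalf (Q := (· ∈ dampedSet (c / 3) F)) hd (fun q hq => ?_) hp
    have h := isometry_mem_dampedSet (ρ := ρ) (fun q => by rw [hρ, hF1]) hq
    rwa [hρ] at h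
  exact ⟨F, f, isBackwardImage_iff.2 ⟨hFe, hF1, hF2, hF3⟩, hf, hfe.mono hsub,
    fun p hp => hfh p (hsub hp)⟩

theorem IsBackwardImage.eqOn_triangle {g' F F' : Plane → ℝ} (hgg' : Set.EqOn g g' sixth)
    (hF : IsBackwardImage g F) (hF' : IsBackwardImage g' F') : Set.EqOn F F' triangle := by
  obtain ⟨h, h1, -⟩ := isBackwardImage_iff.1 hF
  obtain ⟨k, k1, -⟩ := isBackwardImage_iff.1 hF'
  intro p hp
  refine triangle_induction_lowerHalf (Q := fun p => F p = F' p) (fun q hq => ?_)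
    (fun q hq => ?_) hp
  · rw [h hq, k hq]
    exact hgg' (trans_mem_sixth.2 hq)
  · rw [h1, k1, hq]

theorem IsBackwardImage.mem_classes {F : Plane → ℝ} (hg : g ∈ classA2 c)
    (hF : IsBackwardImage g F) : F ∈ classA2 (c / 3) ∪ classE2 (c / 3) := by
  obtain ⟨F', f, hF', hf, hfF, hfh⟩ := exists_isBackwardImage hg
  obtain ⟨hX, hUV⟩ := odd_of_mem_classA2 hg
  have hFF' := hF.eqOn_triangle (fun _ _ => rfl) hF'
  obtain ⟨h, h1, h2, h3⟩ := isBackwardImage_iff.1 hF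
  have hsol : IsDirichletSolution (c / 3) F := by
    refine .of_contDiff hf (hfF.trans hFF'.symm) hfh
      (fun p _ hp => eq_zero_of_odd_backward h1 h2 h3 hp) ?_
    by_contra! hn
    obtain ⟨p, hp, hne⟩ := hg.1.nontrivial
    refine hne (triangle_induction_sixth (Q := fun p => p ∈ triangle ∧ g p = 0)
      (fun q hq => ⟨sixth_subset_triangle hq, ?_⟩)
      (fun q hq => ⟨mirrorX_mem_triangle hq.1, by rw [hX q hq.1, hq.2, neg_zero]⟩)
      (fun q hq => ⟨mirrorUV_mem_triangle hq.1, by rw [hUV q hq.1, hq.2, neg_zero]⟩) hp).2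
    obtain ⟨r, rfl⟩ := trans.surjective q
    have hr := trans_mem_sixth.1 hq
    rw [show g (trans r) = F r from (h hr).symm]
    exact hn r (lowerHalf_subset_triangle hr)
  have hodd : Set.EqOn (act reflectionMatrix F) (-F) triangle := fun p _ => by
    rw [act_reflectionMatrix, h1]
    rfl
  by_cases hrot : Set.EqOn (act rotationMatrix F) F triangle
  · exact Or.inl ⟨hsol, hrot, hodd⟩
  · refine Or.inr ⟨hsol, hrot, fun hneg => ?_, hodd⟩
    -- the rotation has order three, so it cannot act by the sign `-1`
    obtain ⟨p, hp, hne⟩ := hsol.nontrivial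
    have hr : ∀ q ∈ triangle, F (rotInv q) = -F q := fun q hq => by
      exact (act_rotationMatrix _ q).symm.trans (hneg hq)
    have h4 := hr _ (rotInv_mem_triangle (rotInv_mem_triangle hp))
    rw [rotInv_rotInv_rotInv, hr _ (rotInv_mem_triangle hp), hr _ hp] at h4
    exact hne (by linarith)

end Backward

/-! ### The constructions are inverse to each other -/

section Inverse

theorem IsBackwardImage.eqOn_of_isForwardImage {f G F : Plane → ℝ}
    (hX : ∀ p ∈ triangle, f (mirrorX p) = -f p) (hG : IsForwardImage f G)
    (hF : IsBackwardImage G F) : Set.EqOn F f triangle := by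
  obtain ⟨h, h1, -⟩ := isBackwardImage_iff.1 hF
  intro p hp
  refine (triangle_induction_lowerHalf (Q := fun p => p ∈ triangle ∧ F p = f p)
    (fun q hq => ⟨lowerHalf_subset_triangle hq, ?_⟩)
    (fun q hq => ⟨mirrorX_mem_triangle hq.1, by rw [h1, hX q hq.1, hq.2]⟩) hp).2
  rw [h hq, Function.comp, (isForwardImage_iff.1 hG).1 (trans_mem_sixth.2 hq)]
  simp

theorem IsForwardImage.eqOn_of_isBackwardImage {g F G : Plane → ℝ} {c : ℝ} (hg : g ∈ classA2 c)
    (hF : IsBackwardImage g F) (hG : IsForwardImage F G) : Set.EqOn G g triangle := by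
  obtain ⟨hX, hUV⟩ := odd_of_mem_classA2 hg
  obtain ⟨h, -, h2, h3⟩ := isForwardImage_iff.1 hG
  intro p hp
  refine (triangle_induction_sixth (Q := fun p => p ∈ triangle ∧ G p = g p)
    (fun q hq => ⟨sixth_subset_triangle hq, ?_⟩)
    (fun q hq => ⟨mirrorX_mem_triangle hq.1, by rw [h3, hX q hq.1, hq.2]⟩)
    (fun q hq => ⟨mirrorUV_mem_triangle hq.1, by rw [h2, hUV q hq.1, hq.2]⟩) hp).2
  obtain ⟨r, rfl⟩ := trans.surjective q
  rw [h hq, Function.comp, trans.symm_apply_apply, (isBackwardImage_iff.1 hF).1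
    (trans_mem_sixth.1 hq)]
  rfl

end Inverse

end

end EquilateralHelmholtz

theorem mainTheorem3 (k : ℝ) :
    -- from the classes E2 and A2 with scalar `k²` to the class A2 with scalar `3k²`
    (∀ f ∈ EquilateralHelmholtz.classE2 (k ^ 2) ∪ EquilateralHelmholtz.classA2 (k ^ 2),
      (∃ G, EquilateralHelmholtz.IsForwardImage f G) ∧
      ∀ G, EquilateralHelmholtz.IsForwardImage f G →
        G ∈ EquilateralHelmholtz.classA2 (3 * k ^ 2) ∧
        ∀ F, EquilateralHelmholtz.IsBackwardImage G F →
          Set.EqOn F f EquilateralHelmholtz.triangle) ∧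
    -- from the class A2 with scalar `k²` to the classes A2 and E2 with scalar `k²/3`
    (∀ g ∈ EquilateralHelmholtz.classA2 (k ^ 2),
      (∃ F, EquilateralHelmholtz.IsBackwardImage g F) ∧
      ∀ F, EquilateralHelmholtz.IsBackwardImage g F →
        F ∈ EquilateralHelmholtz.classA2 (k ^ 2 / 3) ∪ EquilateralHelmholtz.classE2 (k ^ 2 / 3) ∧
        ∀ G, EquilateralHelmholtz.IsForwardImage F G →
          Set.EqOn G g EquilateralHelmholtz.triangle) := by
  refine ⟨fun f hf => ?_, fun g hg => ?_⟩
  · obtain ⟨hs, hX⟩ := EquilateralHelmholtz.isDirichletSolution_and_odd hf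
    obtain ⟨G, -, hG, -⟩ := EquilateralHelmholtz.exists_isForwardImage hs hX
    exact ⟨⟨G, hG⟩, fun G hG => ⟨hG.mem_classA2 hs hX,
      fun F hF => hF.eqOn_of_isForwardImage hX hG⟩⟩
  · obtain ⟨F, -, hF, -⟩ := EquilateralHelmholtz.exists_isBackwardImage hg
    exact ⟨⟨F, hF⟩, fun F hF => ⟨hF.mem_classes hg,
      fun G hG => hG.eqOn_of_isBackwardImage hg hF⟩⟩
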